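/- Let $d\ge 1$ be an integer and $\Lambda>0$. Let $S_{d-1}=2\pi^{d/2}/\Gamma(d/2)$ be the area of the unit sphere $\mathbb S^{d-1}\subset\mathbb R^d$ and let $\sigma$ be its surface measure (for $d=1$: counting measure on $\{-1,1\}$). For $s>0$ put $$G(s)=\begin{cases}-s/2,& d=1,\\ -\frac{1}{2\pi}\ln s,& d=2,\\ \dfrac{s^{2-d}}{(d-2)S_{d-1}},& d\ge 3,\end{cases}\qquad s_\Lambda=\begin{cases}s,& s>1/\Lambda,\\ 1/\Lambda,& 0\le s\le 1/\Lambda .\end{cases}$$ Then the function $x\mapsto G(|x|_\Lambda)$ defines a tempered distribution on $\mathbb R^d$, and its Fourier transform is, in the sense of tempered distributions in $k\in\mathbb R^d$, $$\int_{\mathbb R^d}e^{ik\cdot x}\,G(|x|_\Lambda)\,d^dx=\frac{1}{S_{d-1}|k|^2}\int_{\mathbb S^{d-1}}e^{ik\cdot y/\Lambda}\,d\sigma(y).$$ Here the Fourier transform $\mathcal F T$ of a tempered distribution $T$ is defined by $\langle \mathcal F T,\varphi\rangle=\langle T,\hat\varphi\rangle$ with $\hat\varphi(x)=\int_{\mathbb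 R^d} e^{ik\cdot x}\varphi(k)\,d^dk$ for Schwartz functions $\varphi$, and the right-hand side is the product of the smooth function $\frac1{S_{d-1}}\int_{\mathbb S^{d-1}}e^{ik\cdot y/\Lambda}d\sigma(y)$ with the distribution $1/|k|^2$. The latter is the locally integrable function $1/|k|^2$ if $d\ge3$; if $d=1,2$, where $1/|k|^2$ is not locally integrable at the origin, it is the finite part $$\Big\langle \tfrac1{k^2},\psi\Big\rangle=\int_0^\infty\frac{\psi(t)+\psi(-t)-2\psi(0)}{t^2}\,dt\quad(d=1),$$ $$\Big\langle \tfrac1{|k|^2},\psi\Big\rangle=\int_{|k|<R}\frac{\psi(k)-\psi(0)}{|k|^2}\,d^2k+\int_{|k|\ge R}\frac{\psi(k)}{|k|^2}\,d^2k,\quad R=2e^{-\gamma}\quad(d=2),$$ where $\gamma$ is the Euler–Mascheroni constant. All integrals in these pairings converge absolutely. -/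

import Mathlib

open MeasureTheory
open scoped SchwartzMap FourierTransform

noncomputable section

namespace CutoffGreen

/-- `ℝᵈ` with the Euclidean norm. -/
abbrev Space (d : ℕ) : Type := EuclideanSpace ℝ (Fin d)

/-- The area `S_{d-1} = 2 π^{d/2} / Γ(d/2)` of the unit sphere of `ℝᵈ`. -/
def sphereArea (d : ℕ) : ℝ := 2 * Real.pi ^ ((d : ℝ) / 2) / Real.Gamma ((d : ℝ) / 2)

/-- The fundamental solution of `-∑ ∂²` on `ℝᵈ`, `d ≥ 1`, as a function of the radius `s`. -/
def green (d : ℕ) (s : ℝ) : ℝ :=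
  if d = 1 then -s / 2
  else if d = 2 then -Real.log s / (2 * Real.pi)
  else s ^ (2 - (d : ℤ)) / (((d : ℝ) - 2) * sphereArea d)

/-- The cutoff `s ↦ s_Λ`: it is `s` for `s > 1/Λ` and `1/Λ` for `s ≤ 1/Λ`. -/
def cutoff (Λ s : ℝ) : ℝ := if 1 / Λ < s then s else 1 / Λ

/-- `∫_{𝕊^{d-1}} e^{i k·y/Λ} dσ(y)`, with `σ` the surface measure of the unit sphere
(counting measure on `{-1, 1}` when `d = 1`). -/
def sphereWave (d : ℕ) (Λ : ℝ) (k : Space d) : ℂ :=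
  ∫ y : Metric.sphere (0 : Space d) 1,
    Complex.exp (Complex.I * ((inner ℝ k (y : Space d) / Λ : ℝ) : ℂ))
    ∂((volume : Measure (Space d)).toSphere)

/-- The integrand of the pairing `⟨1/|k|², ψ⟩ = ∫ k, invNormSqIntegrand d ψ k`.
For `d ≥ 3` the function `1/|k|²` is locally integrable and this is `ψ(k)/|k|²`.
For `d = 1` it gives the Hadamard finite part, `∫_0^∞ (ψ(t) + ψ(-t) - 2 ψ(0)) / t² dt`.
For `d = 2` it gives the finite part
`∫_{|k| < R} (ψ(k) - ψ(0)) / |k|² dk + ∫_{|k| ≥ R} ψ(k) / |k|² dk` with `R = 2 e^{-γ}`,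
`γ` being the Euler-Mascheroni constant. -/
def invNormSqIntegrand (d : ℕ) (ψ : Space d → ℂ) (k : Space d) : ℂ :=
  (if d = 1 then (ψ k + ψ (-k)) / 2 - ψ 0
    else if d = 2 then
      (if ‖k‖ < 2 * Real.exp (-Real.eulerMascheroniConstant) then ψ k - ψ 0 else ψ k)
    else ψ k) / ((‖k‖ ^ 2 : ℝ) : ℂ)

/-- Multiplication by `1/(2π)` on `ℝᵈ`. -/
def scaleEquiv (d : ℕ) : Space d ≃L[ℝ] Space d :=
  ContinuousLinearEquiv.smulLeft
    (Units.mk0 ((2 * Real.pi)⁻¹ : ℝ) (inv_ne_zero Real.two_pi_pos.ne'))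

/-- The Fourier transform of Schwartz functions, `φ ↦ (x ↦ ∫ e^{i k·x} φ(k) dk)`. -/
def waveFourier (d : ℕ) : 𝓢(Space d, ℂ) →L[ℂ] 𝓢(Space d, ℂ) :=
  (SchwartzMap.compCLMOfContinuousLinearEquiv ℂ (scaleEquiv d)).comp
    (FourierTransform.fourierInvCLM ℂ 𝓢(Space d, ℂ))

theorem waveFourier_apply (d : ℕ) (φ : 𝓢(Space d, ℂ)) (x : Space d) :
    waveFourier d φ x =
      ∫ k : Space d, Complex.exp (Complex.I * ((inner ℝ k x : ℝ) : ℂ)) * φ k := by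
  have h : waveFourier d φ x = 𝓕⁻ (φ : Space d → ℂ) ((2 * Real.pi)⁻¹ • x) := by
    rw [← SchwartzMap.fourierInv_coe]; rfl
  rw [h, Real.fourierInv_eq']
  congr 1
  ext k
  rw [smul_eq_mul, real_inner_smul_right]
  congr 2
  have : (Real.pi : ℂ) ≠ 0 := by exact_mod_cast Real.pi_ne_zero
  push_cast
  field_simp

/-- The Fourier transform `F[T] = "∫ e^{i k·x} T(x) dx"` of a tempered distribution,
`⟨F[T], φ⟩ = ⟨T, x ↦ ∫ e^{i k·x} φ(k) dk⟩`. -/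
def distFourier (d : ℕ) : 𝓢'(Space d, ℂ) →L[ℂ] 𝓢'(Space d, ℂ) :=
  PointwiseConvergenceCLM.precomp ℂ (waveFourier d)

theorem distFourier_apply (d : ℕ) (T : 𝓢'(Space d, ℂ)) (φ : 𝓢(Space d, ℂ)) :
    distFourier d T φ = T (waveFourier d φ) := rfl

/-- `T` is the tempered distribution `G(|x|_Λ)`, i.e. integration against this function. -/
def IsCutoffGreen (d : ℕ) (Λ : ℝ) (T : 𝓢'(Space d, ℂ)) : Prop :=
  ∀ φ : 𝓢(Space d, ℂ),
    Integrable (fun x : Space d => ((green d (cutoff Λ ‖x‖) : ℝ) : ℂ) * φ x) ∧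
    T φ = ∫ x : Space d, ((green d (cutoff Λ ‖x‖) : ℝ) : ℂ) * φ x

/-- `U` is the tempered distribution `(1/(S_{d-1} |k|²)) ∫_{𝕊^{d-1}} e^{i k·y/Λ} dσ(y)`, the
product of the distribution `1/|k|²` with a smooth function of `k`. -/
def IsSphereWaveOverNormSq (d : ℕ) (Λ : ℝ) (U : 𝓢'(Space d, ℂ)) : Prop :=
  ∀ φ : 𝓢(Space d, ℂ),
    Integrable (invNormSqIntegrand d (fun k => sphereWave d Λ k * φ k)) ∧
    U φ = 1 / (sphereArea d : ℂ) *
      ∫ k : Space d, invNormSqIntegrand d (fun k => sphereWave d Λ k * φ k) k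

end CutoffGreen

end

/-! Write G for `green d` and S for `sphereArea d`. The proof treats the uncut G and the effect of
the cutoff separately.

The uncut G is a time integral of the heat kernel. That integral converges for d ≥ 3; for d = 1 and
d = 2 a multiple of the kernel's value at the origin is subtracted first, at all times for d = 1 and
at times t > 1 for d = 2. The result is G + c with c = `heatConst d` (`integral_heat`). The heat
kernel has Fourier transform e^{-t|k|²}, and, paired with the transform of φ, the subtracted
constant becomes a multiple of φ(0) ∫ e^{-t|k|²} dk. Exchanging the time integral with the space
integrals thus gives (φ(k) - χ(k) φ(0))/|k|², where χ = 1 for d = 1 (after symmetrising φ), χ =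
e^{-|k|²} for d = 2 and χ = 0 for d ≥ 3 (`integral_green_mul_waveFourier`). For d = 2, replacing
e^{-|k|²} by the indicator of |k| < R costs a multiple of φ(0), and R = 2e^{-γ} is the radius for
which this cost cancels the contribution of c (`integral_finitePartGap`).

For the cutoff, G(|x|_Λ) = G(|x|) - S⁻¹ ∫_{|x|}^{1/Λ} s^{1-d} ds, the integral being absent for |x|
> 1/Λ. The radial integral superposes indicators of balls, so its Fourier transform F(k) is
∫_0^{1/Λ} s^{1-d} (∫_{|x|<s} e^{ik·x} dx) ds. Since div(k e^{ik·x}) = i|k|² e^{ik·x}, the divergence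
theorem turns |k|² times the ball integral into a flux through the sphere, which is up to a factor
the radial derivative of the spherical integral of the wave. Integrating in s telescopes: |k|² F(k)
= S - `sphereWave d Λ k` (`normSq_mul_integral_planeWave`).

Finally, `sphereWave` equals S at the origin and S - |k|² F elsewhere, so the finite part of 1/|k|²
on `sphereWave` · φ is S times that on φ minus ∫ F φ. This is S times the transform of the cutoff
function paired with φ. -/

noncomputable section

namespace CutoffGreen

/-! ### Plane waves, distributions of linear growth, the multiplication formula -/

section General

variable {E : Type*} [NormedAddCommGroup E] [InnerProductSpace ℝ E]

/-- The plane wave `e^{i k·x}`. -/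
def planeWave (k x : E) : ℂ := Complex.exp (Complex.I * ((inner ℝ k x : ℝ) : ℂ))

theorem norm_planeWave (k x : E) : ‖planeWave k x‖ = 1 := by
  rw [planeWave, mul_comm, Complex.norm_exp_ofReal_mul_I]

theorem continuous_planeWave_uncurry : Continuous (fun p : E × E => planeWave p.1 p.2) := by
  unfold planeWave; fun_prop

theorem continuous_planeWave (k : E) : Continuous (planeWave k) := by
  unfold planeWave; fun_prop

variable [MeasurableSpace E] [BorelSpace E]

theorem _root_.MeasureTheory.Integrable.mul_planeWave {μ : Measure E} {f : E → ℂ}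
    (hf : Integrable f μ) (k : E) : Integrable (fun x => f x * planeWave k x) μ :=
  hf.mul_bdd (c := 1) (continuous_planeWave k).aestronglyMeasurable
    (Filter.Eventually.of_forall fun x => (norm_planeWave k x).le)

variable [FiniteDimensional ℝ E]

/-- A measurable function of at most linear growth defines a tempered distribution. -/
theorem exists_temperedDistribution_of_norm_le {f : E → ℂ} (hf : AEStronglyMeasurable f)
    {C : ℝ} (hC : ∀ x, ‖f x‖ ≤ C * (1 + ‖x‖)) :
    ∃ T : 𝓢'(E, ℂ), ∀ φ : 𝓢(E, ℂ), Integrable (fun x => f x * φ x) ∧ T φ = ∫ x, f x * φ x := by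
  have hC0 : 0 ≤ C := by have := (norm_nonneg _).trans (hC 0); simpa using this
  have hpt : ∀ (φ : 𝓢(E, ℂ)) (x : E), ‖f x * φ x‖ ≤ C * (‖φ x‖ + ‖x‖ * ‖φ x‖) := by
    intro φ x
    rw [norm_mul]
    calc ‖f x‖ * ‖φ x‖ ≤ C * (1 + ‖x‖) * ‖φ x‖ := by gcongr; exact hC x
      _ = _ := by ring
  have hdom : ∀ φ : 𝓢(E, ℂ), Integrable (fun x : E => C * (‖φ x‖ + ‖x‖ * ‖φ x‖)) := fun φ => by
    have := φ.integrable_pow_mul volume 1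
    simp only [pow_one] at this
    exact ((φ.integrable (μ := volume)).norm.add this).const_mul C
  have hint : ∀ φ : 𝓢(E, ℂ), Integrable (fun x => f x * φ x) := fun φ =>
    (hdom φ).mono' (hf.mul φ.continuous.aestronglyMeasurable) (Filter.Eventually.of_forall (hpt φ))
  let n := (volume : Measure E).integrablePower
  let I := 2 ^ n * ∫ x : E, (1 + ‖x‖) ^ (-(n : ℝ))
  have hI : 0 ≤ I := by positivity
  let A : 𝓢(E, ℂ) →L[ℂ] ℂ := SchwartzMap.mkCLMtoNormedSpace (fun φ => ∫ x, f x * φ x)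
    (fun φ ψ => by
      rw [← integral_add (hint φ) (hint ψ)]
      simp [mul_add])
    (fun a φ => by
      simp only [smul_apply, smul_eq_mul, RingHom.id_apply]
      rw [← integral_const_mul]
      congr 1 with x
      ring)
    -- The integrals of ‖φ‖ and ‖x‖ ‖φ‖ need the seminorms of weights 0, n and 1, 1 + n, where (1 +
    -- ‖x‖)^{-n} is integrable. Weight 1 need not be listed: the family bound `M` is asked of (0,
    -- 0), (n, 0), (1 + n, 0) only if weight 1 is not called for.
    ⟨{(0, 0), (n, 0), (1 + n, 0)}, C * (I * 4), by positivity, fun φ => by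
      set s : Finset (ℕ × ℕ) := {(0, 0), (n, 0), (1 + n, 0)}
      set M := s.sup (schwartzSeminormFamily ℂ E ℂ) φ
      have hM : ∀ p ∈ s, SchwartzMap.seminorm ℂ p.1 p.2 φ ≤ M := fun p hp => by
        have := Finset.le_sup (f := schwartzSeminormFamily ℂ E ℂ) hp
        exact this φ
      have h0 : ∫ x, ‖φ x‖ ≤ I * (M + M) := by
        have := SchwartzMap.integral_pow_mul_iteratedFDeriv_le ℂ volume φ 0 0
        simp only [pow_zero, one_mul, norm_iteratedFDeriv_zero, zero_add] at this
        refine this.trans ?_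
        gcongr
        · exact hM (0, 0) (by simp [s])
        · exact hM (n, 0) (by simp [s])
      have h1 : ∫ x, ‖x‖ * ‖φ x‖ ≤ I * (M + M) := by
        have := SchwartzMap.integral_pow_mul_iteratedFDeriv_le ℂ volume φ 1 0
        simp only [pow_one, norm_iteratedFDeriv_zero] at this
        refine this.trans ?_
        gcongr
        · exact hM (0, 0) (by simp [s])
        · exact hM (1 + n, 0) (by simp [s])
      calc ‖∫ x, f x * φ x‖ ≤ ∫ x, C * (‖φ x‖ + ‖x‖ * ‖φ x‖) :=
            norm_integral_le_of_norm_le (hdom φ) (Filter.Eventually.of_forall (hpt φ))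
        _ = C * ((∫ x, ‖φ x‖) + ∫ x, ‖x‖ * ‖φ x‖) := by
            have := φ.integrable_pow_mul volume 1
            simp only [pow_one] at this
            rw [integral_const_mul, integral_add (φ.integrable (μ := volume)).norm this]
        _ ≤ C * (I * (M + M) + I * (M + M)) := by gcongr
        _ = C * (I * 4) * M := by ring⟩
  exact ⟨ContinuousLinearMap.toPointwiseConvergenceCLM _ _ _ _ A, fun φ => ⟨hint φ, rfl⟩⟩

theorem integrable_mul_planeWave_mul_prod {f φ : E → ℂ} (hf : Integrable f) (hφ : Integrable φ) :
    Integrable (fun p : E × E => f p.1 * planeWave p.2 p.1 * φ p.2) (volume.prod volume) := by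
  have h := hf.mul_prod hφ
  refine (h.bdd_mul (c := 1) (f := fun p : E × E => planeWave p.2 p.1) ?_ ?_).congr ?_
  · exact (continuous_planeWave_uncurry.comp continuous_swap).aestronglyMeasurable
  · exact Filter.Eventually.of_forall fun p => (norm_planeWave _ _).le
  · exact Filter.Eventually.of_forall fun p => by ring

theorem integrable_integral_planeWave_mul {f φ : E → ℂ} (hf : Integrable f) (hφ : Integrable φ) :
    Integrable fun k => (∫ x, f x * planeWave k x) * φ k := by
  have h := (integrable_mul_planeWave_mul_prod hf hφ).integral_prod_right
  simpa only [integral_mul_const] using h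

/-- The multiplication formula for the Fourier transform. -/
theorem integral_mul_integral_planeWave {f φ : E → ℂ} (hf : Integrable f) (hφ : Integrable φ) :
    ∫ x, f x * ∫ k, planeWave k x * φ k = ∫ k, (∫ x, f x * planeWave k x) * φ k := by
  simp_rw [← integral_const_mul, ← integral_mul_const, ← mul_assoc]
  exact integral_integral_swap (integrable_mul_planeWave_mul_prod hf hφ)

end General

theorem waveFourier_eq (d : ℕ) (φ : 𝓢(Space d, ℂ)) (x : Space d) :
    waveFourier d φ x = ∫ k : Space d, planeWave k x * φ k :=
  waveFourier_apply d φ x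

/-- Fourier inversion at the origin; the factor (2π)^d is the Jacobian of the rescaling built into
`waveFourier`. -/
theorem integral_waveFourier (d : ℕ) (φ : 𝓢(Space d, ℂ)) :
    ∫ x, waveFourier d φ x = ((2 * Real.pi) ^ d : ℝ) * φ 0 := by
  have h : ∀ x, waveFourier d φ x = (𝓕⁻ φ) ((2 * Real.pi)⁻¹ • x) := fun x => rfl
  simp_rw [h]
  refine (Measure.integral_comp_smul volume (fun x => (𝓕⁻ φ) x) _).trans ?_
  rw [finrank_euclideanSpace_fin]
  have h2 : ∫ x, (𝓕⁻ φ) x = φ 0 := by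
    have : 𝓕 (𝓕⁻ φ) = φ := by simp
    conv_rhs => rw [← this, SchwartzMap.fourier_coe, Real.fourier_eq']
    simp
  rw [h2]
  have hpi : 0 < Real.pi := Real.pi_pos
  rw [inv_pow, inv_inv, abs_of_pos (by positivity)]
  rfl

end CutoffGreen

end

noncomputable section

namespace CutoffGreen

/-! ### Polar coordinates and superpositions of balls -/

section Sphere

open Set Metric Module

variable {E : Type*} [NormedAddCommGroup E] [InnerProductSpace ℝ E] [FiniteDimensional ℝ E]
  [MeasurableSpace E] [BorelSpace E]

/-- Integration in polar coordinates. -/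
theorem integral_eq_integral_Ioi_toSphere [Nontrivial E] {f : E → ℂ} (hf : Integrable f) :
    ∫ x, f x = ∫ r in Ioi (0 : ℝ), ((r ^ (finrank ℝ E - 1) : ℝ) : ℂ) *
      ∫ y : sphere (0 : E) 1, f (r • (y : E)) ∂(volume : Measure E).toSphere := by
  have hmp := (volume : Measure E).measurePreserving_homeomorphUnitSphereProd
  have hemb := (homeomorphUnitSphereProd E).measurableEmbedding
  let F : sphere (0 : E) 1 × Ioi (0 : ℝ) → ℂ := fun p => f ((p.2 : ℝ) • (p.1 : E))
  have hF : ∀ x : ({0}ᶜ : Set E), F (homeomorphUnitSphereProd E x) = f x := by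
    intro x
    have h := congrArg Subtype.val ((homeomorphUnitSphereProd E).symm_apply_apply x)
    simp only [homeomorphUnitSphereProd_symm_apply_coe] at h
    simp only [F, h]
  have hint : Integrable F ((volume : Measure E).toSphere.prod
      (Measure.volumeIoiPow (finrank ℝ E - 1))) := by
    rw [← hmp.integrable_comp_emb hemb]
    have : F ∘ homeomorphUnitSphereProd E = fun x : ({0}ᶜ : Set E) => f x := funext hF
    rw [this]
    exact (integrableOn_iff_comap_subtypeVal (measurableSet_singleton _).compl).1 hf.integrableOn
  calc ∫ x, f x = ∫ x : ({(0)}ᶜ : Set E), f x ∂((volume : Measure E).comap (↑)) := by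
        rw [integral_subtype_comap (measurableSet_singleton _).compl fun x ↦ f x,
          restrict_compl_singleton]
    _ = ∫ p, F p ∂((volume : Measure E).toSphere.prod
          (Measure.volumeIoiPow (finrank ℝ E - 1))) := by
        rw [← hmp.integral_comp hemb]
        simp_rw [hF]
    _ = ∫ r : Ioi (0 : ℝ), (∫ y, F (y, r) ∂(volume : Measure E).toSphere)
          ∂(Measure.volumeIoiPow (finrank ℝ E - 1)) := integral_prod_symm _ hint
    _ = _ := by
        simp only [Measure.volumeIoiPow, ENNReal.ofReal]
        rw [integral_withDensity_eq_integral_smul]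
        · rw [← integral_subtype_comap measurableSet_Ioi]
          refine integral_congr_ae (Filter.Eventually.of_forall fun r => ?_)
          have hr : (0 : ℝ) < r := r.2
          simp only [F]
          rw [NNReal.smul_def, Real.coe_toNNReal _ (pow_nonneg hr.le _), Complex.real_smul]
        · exact (measurable_subtype_coe.pow_const _).real_toNNReal

/-- The integral of a plane wave over a ball. -/
def ballWave (k : E) (s : ℝ) : ℂ := ∫ x in ball (0 : E) s, planeWave k x

/-- The slice at `s` is `w s` on a ball whose volume is proportional to s^n, with n the dimension;
hence the hypothesis on s^n `w s`. For the weight s^{1-n} used later this product is just s. -/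
theorem integrable_indicator_norm_lt [Nontrivial E] {a : ℝ} {w : ℝ → ℝ} (hw : Measurable w)
    (hwi : IntegrableOn (fun s => s ^ finrank ℝ E * w s) (Ioo 0 a)) :
    Integrable (fun p : ℝ × E => (({p : ℝ × E | ‖p.2‖ < p.1}.indicator (fun p => w p.1) p : ℝ) : ℂ))
      ((volume.restrict (Ioo 0 a)).prod volume) := by
  suffices h : Integrable ({p : ℝ × E | ‖p.2‖ < p.1}.indicator (fun p => w p.1))
      ((volume.restrict (Ioo 0 a)).prod volume) from h.ofReal
  have hmeas : MeasurableSet {p : ℝ × E | ‖p.2‖ < p.1} :=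
    measurableSet_lt measurable_snd.norm measurable_fst
  have hsl : ∀ s : ℝ, (fun x : E => {p : ℝ × E | ‖p.2‖ < p.1}.indicator (fun p => w p.1) (s, x)) =
      (ball (0 : E) s).indicator (fun _ => w s) := by
    intro s; ext x; simp [indicator]
  have hm : AEStronglyMeasurable ({p : ℝ × E | ‖p.2‖ < p.1}.indicator (fun p => w p.1))
      ((volume.restrict (Ioo 0 a)).prod volume) :=
    ((hw.comp measurable_fst).indicator hmeas).aestronglyMeasurable
  rw [integrable_prod_iff hm]
  refine ⟨Filter.Eventually.of_forall fun s => ?_, ?_⟩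
  · rw [hsl, integrable_indicator_iff measurableSet_ball]
    exact integrableOn_const (measure_ball_lt_top.ne)
  · have : ∀ s ∈ Ioo 0 a, ∫ x : E, ‖{p : ℝ × E | ‖p.2‖ < p.1}.indicator (fun p => w p.1) (s, x)‖ =
        volume.real (ball (0 : E) 1) * ‖s ^ finrank ℝ E * w s‖ := by
      intro s hs
      have h1 := hsl s
      have : ∀ x : E, {p : ℝ × E | ‖p.2‖ < p.1}.indicator (fun p => w p.1) (s, x) =
        (ball (0 : E) s).indicator (fun _ => w s) x := fun x => congrFun h1 x
      simp_rw [this, norm_indicator_eq_indicator_norm]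
      rw [integral_indicator measurableSet_ball, setIntegral_const, Measure.real,
        Measure.addHaar_ball _ _ hs.1.le, ENNReal.toReal_mul, ENNReal.toReal_ofReal (by
          have := hs.1; positivity), norm_mul, Real.norm_of_nonneg (by have := hs.1; positivity :
          0 ≤ s ^ finrank ℝ E), smul_eq_mul, Measure.real]
      ring
    refine IntegrableOn.congr_fun (hwi.norm.const_mul _) (fun s hs => (this s hs).symm)
      measurableSet_Ioo

theorem integrable_indicator_norm_lt_mul_planeWave [Nontrivial E] {a : ℝ} {w : ℝ → ℝ}
    (hw : Measurable w) (hwi : IntegrableOn (fun s => s ^ finrank ℝ E * w s) (Ioo 0 a)) (k : E) :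
    Integrable (fun p : ℝ × E =>
      (({p : ℝ × E | ‖p.2‖ < p.1}.indicator (fun p => w p.1) p : ℝ) : ℂ) * planeWave k p.2)
      ((volume.restrict (Ioo 0 a)).prod volume) :=
  (integrable_indicator_norm_lt hw hwi).mul_bdd (c := 1)
    ((continuous_planeWave k).comp continuous_snd).aestronglyMeasurable
    (Filter.Eventually.of_forall fun _ => (norm_planeWave k _).le)

omit [InnerProductSpace ℝ E] [FiniteDimensional ℝ E] [MeasurableSpace E] [BorelSpace E] in
theorem integral_indicator_norm_lt_eq (a : ℝ) (w : ℝ → ℝ) (x : E) :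
    ∫ s in Ioo 0 a, (({p : ℝ × E | ‖p.2‖ < p.1}.indicator (fun p => w p.1) (s, x) : ℝ) : ℂ) =
      ((∫ s in Ioo ‖x‖ a, w s : ℝ) : ℂ) := by
  rw [integral_complex_ofReal]
  congr 1
  have : ∀ s, {p : ℝ × E | ‖p.2‖ < p.1}.indicator (fun p => w p.1) (s, x) =
      (Ioi ‖x‖).indicator w s := fun s => by simp [indicator]
  simp_rw [this]
  rw [setIntegral_indicator measurableSet_Ioi]
  congr 2
  ext s
  simp only [mem_inter_iff, mem_Ioo, mem_Ioi]
  have := norm_nonneg x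
  constructor
  · rintro ⟨⟨_, h⟩, h'⟩; exact ⟨h', h⟩
  · rintro ⟨h', h⟩; exact ⟨⟨by linarith, h⟩, h'⟩

theorem integral_indicator_norm_lt_mul_planeWave (s : ℝ) (w : ℝ → ℝ) (k : E) :
    ∫ x : E, (({p : ℝ × E | ‖p.2‖ < p.1}.indicator (fun p => w p.1) (s, x) : ℝ) : ℂ) *
      planeWave k x = w s * ballWave k s := by
  rw [ballWave, ← integral_indicator measurableSet_ball, ← integral_const_mul]
  congr 1 with x
  by_cases h : ‖x‖ < s <;> simp [indicator, h]

/-- A radial function which is a superposition of indicators of balls is integrable. -/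
theorem integrable_integral_Ioo_norm [Nontrivial E] {a : ℝ} {w : ℝ → ℝ} (hw : Measurable w)
    (hwi : IntegrableOn (fun s => s ^ finrank ℝ E * w s) (Ioo 0 a)) :
    Integrable (fun x : E => ((∫ s in Ioo ‖x‖ a, w s : ℝ) : ℂ)) := by
  have := (integrable_indicator_norm_lt (E := E) hw hwi).integral_prod_right
  simpa only [integral_indicator_norm_lt_eq] using this

/-- Fubini on the region ‖x‖ < s < a: integrating first in s gives the radial function, integrating
first in x gives `ballWave`. -/
theorem integral_integral_Ioo_norm_mul_planeWave [Nontrivial E] {a : ℝ} {w : ℝ → ℝ}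
    (hw : Measurable w) (hwi : IntegrableOn (fun s => s ^ finrank ℝ E * w s) (Ioo 0 a)) (k : E) :
    ∫ x : E, ((∫ s in Ioo ‖x‖ a, w s : ℝ) : ℂ) * planeWave k x =
      ∫ s in Ioo 0 a, w s * ballWave k s := by
  simp_rw [← integral_indicator_norm_lt_eq, ← integral_indicator_norm_lt_mul_planeWave,
    ← integral_mul_const]
  rw [integral_integral_swap]
  exact (integrable_indicator_norm_lt_mul_planeWave hw hwi k).swap

theorem integrableOn_ballWave [Nontrivial E] (k : E) (a : ℝ) :
    IntegrableOn (ballWave k) (Ioo 0 a) := by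
  have h : IntegrableOn (fun s : ℝ => s ^ finrank ℝ E * 1) (Ioo 0 a) :=
    ((by fun_prop : Continuous fun s : ℝ => s ^ finrank ℝ E * 1).integrableOn_Icc (a := 0)
      (b := a)).mono_set Ioo_subset_Icc_self
  have := (integrable_indicator_norm_lt_mul_planeWave measurable_const h k).integral_prod_left
  have h2 : ∀ s, ∫ x : E, (({p : ℝ × E | ‖p.2‖ < p.1}.indicator (fun _ => (1 : ℝ)) (s, x) : ℝ) : ℂ) *
      planeWave k x = ballWave k s := fun s => by
    rw [integral_indicator_norm_lt_mul_planeWave s (fun _ => 1) k]; simp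
  simp only [h2] at this
  exact this

/-- `-i` times the radial derivative of the spherical integral of a plane wave. -/
def sphereFlux (k : E) (r : ℝ) : ℂ :=
  ∫ y : sphere (0 : E) 1, ((inner ℝ k (y : E) : ℝ) : ℂ) * planeWave k (r • (y : E))
    ∂(volume : Measure E).toSphere

theorem continuous_sphereFlux (k : E) : Continuous (sphereFlux k) := by
  unfold sphereFlux
  have : Continuous (fun p : ℝ × sphere (0 : E) 1 =>
      ((inner ℝ k (p.2 : E) : ℝ) : ℂ) * planeWave k (p.1 • (p.2 : E))) := by
    unfold planeWave; fun_prop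
  have h := continuous_parametric_integral_of_continuous (μ := (volume : Measure E).toSphere)
    (f := fun r (y : sphere (0 : E) 1) => ((inner ℝ k (y : E) : ℝ) : ℂ) * planeWave k (r • (y : E)))
    this isCompact_univ
  simpa using h

end Sphere

end CutoffGreen

end

noncomputable section

namespace CutoffGreen

/-! ### Divergence theorem on balls and the transform of the radial potential -/

section BallSphere

open Set Metric Module

variable {E : Type*} [NormedAddCommGroup E] [InnerProductSpace ℝ E]

theorem hasLineDerivAt_planeWave (k x v : E) :
    HasLineDerivAt ℝ (planeWave k) (Complex.I * (inner ℝ k v : ℝ) * planeWave k x) x v := by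
  have h1 : HasDerivAt (fun t : ℝ => ((inner ℝ k (x + t • v) : ℝ) : ℂ)) ((inner ℝ k v : ℝ) : ℂ) 0 := by
    have : HasDerivAt (fun t : ℝ => inner ℝ k x + t * inner ℝ k v) (1 * inner ℝ k v) 0 :=
      ((hasDerivAt_id (0 : ℝ)).mul_const _).const_add _
    rw [one_mul] at this
    simpa [inner_add_right, real_inner_smul_right] using this.ofReal_comp
  have h2 := (h1.const_mul Complex.I).cexp
  have h3 : HasDerivAt (fun t : ℝ => planeWave k (x + t • v))
      (Complex.I * (inner ℝ k v : ℝ) * planeWave k x) 0 := by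
    have h4 : x = x + (0 : ℝ) • v := by simp
    rw [mul_comm]
    nth_rw 2 [h4]
    exact h2
  exact h3

theorem hasDerivAt_planeWave_smul (k y : E) (r : ℝ) :
    HasDerivAt (fun r : ℝ => planeWave k (r • y))
      (Complex.I * ((inner ℝ k y : ℝ) : ℂ) * planeWave k (r • y)) r := by
  have h : HasDerivAt (fun r : ℝ => r * inner ℝ k y) (1 * inner ℝ k y) r :=
    (hasDerivAt_id r).mul_const _
  have h2 := (h.ofReal_comp.const_mul Complex.I).cexp
  simp only [planeWave, real_inner_smul_right]
  rw [one_mul, mul_comm] at h2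
  exact h2

theorem hasLineDerivAt_comp_norm_sq {h : ℝ → ℝ} {h' : ℝ} {x : E} (hh : HasDerivAt h h' (‖x‖ ^ 2))
    (v : E) : HasLineDerivAt ℝ (fun x : E => ((h (‖x‖ ^ 2) : ℝ) : ℂ))
      ((2 * h' * inner ℝ x v : ℝ) : ℂ) x v := by
  have h1 : HasDerivAt (fun t : ℝ => x + t • v) v 0 := by
    simpa using ((hasDerivAt_id (0 : ℝ)).smul_const v).const_add x
  have h2 := h1.norm_sq
  simp only [zero_smul, add_zero] at h2
  have h3 : HasDerivAt h h' (‖x + (0 : ℝ) • v‖ ^ 2) := by simpa using hh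
  have h4 := (HasDerivAt.comp (0 : ℝ) h3 h2).ofReal_comp
  have h5 : HasDerivAt (fun t : ℝ => ((h (‖x + t • v‖ ^ 2) : ℝ) : ℂ))
      ((2 * h' * inner ℝ x v : ℝ) : ℂ) 0 := by
    have : 2 * h' * inner ℝ x v = h' * (2 * inner ℝ x v) := by ring
    rw [this]
    exact h4
  exact h5

/-- The substitution σ = s². It identifies a radial primitive, written as a function of ‖x‖², with a
superposition of ball indicators. -/
theorem integral_sq_comp_sqrt {g : ℝ → ℝ} (hg : Continuous g) {B : ℝ} (hB : 0 < B)
    (hgB : ∀ r, B ≤ r → g r = 0) {r : ℝ} (hr : 0 ≤ r) :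
    ∫ σ in B ^ 2..r ^ 2, g (√σ) = -∫ s in Ioo r B, 2 * s * g s := by
  rcases le_total B r with h | h
  · rw [Ioo_eq_empty (by linarith)]
    simp only [Measure.restrict_empty, integral_zero_measure, neg_zero]
    have : ∀ σ ∈ uIcc (B ^ 2) (r ^ 2), g (√σ) = (0 : ℝ) := by
      intro σ hσ
      rw [uIcc_of_le (by gcongr)] at hσ
      exact hgB _ (Real.le_sqrt_of_sq_le hσ.1)
    rw [intervalIntegral.integral_congr this]
    simp
  · have h1 := intervalIntegral.integral_comp_mul_deriv (a := r) (b := B) (f := fun s => s ^ 2)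
      (f' := fun s => 2 * s) (g := fun σ => g (√σ))
      (fun s _ => by simpa using hasDerivAt_pow 2 s) (by fun_prop) (by fun_prop)
    rw [intervalIntegral.integral_symm, ← h1, intervalIntegral.integral_of_le h,
      integral_Ioc_eq_integral_Ioo]
    congr 1
    refine setIntegral_congr_fun measurableSet_Ioo fun s hs => ?_
    simp only [Function.comp, Real.sqrt_sq (hr.trans hs.1.le)]
    ring

variable [FiniteDimensional ℝ E] [MeasurableSpace E] [BorelSpace E]

/-- The divergence theorem on balls for a plane wave, tested against a radial weight. -/
theorem integral_mul_sphereFlux [Nontrivial E] {g : ℝ → ℝ} (hg : Continuous g) {B : ℝ} (hB : 0 < B)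
    (hgB : ∀ r, B ≤ r → g r = 0) (k : E) :
    ∫ r in Ioi (0 : ℝ), ((r ^ (finrank ℝ E - 1) : ℝ) : ℂ) *
        (((2 * r * g r : ℝ) : ℂ) * sphereFlux k r) =
      Complex.I * ((‖k‖ ^ 2 : ℝ) : ℂ) * ∫ s in Ioo 0 B, ((2 * s * g s : ℝ) : ℂ) * ballWave k s := by
  -- A primitive in the variable ‖x‖² is differentiable at the origin too, and the base point B²
  -- makes `h (‖x‖ ^ 2)` vanish for ‖x‖ ≥ B. Integrating by parts in the direction k then has no
  -- boundary term.
  let h : ℝ → ℝ := fun s => ∫ σ in B ^ 2..s, g (√σ)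
  have hcont : Continuous fun σ => g (√σ) := by fun_prop
  have hh : ∀ s, HasDerivAt h (g √s) s := fun s => (hcont.integral_hasStrictDerivAt _ s).hasDerivAt
  have hhc : Continuous h := continuous_iff_continuousAt.2 fun s => (hh s).continuousAt
  have hhr : ∀ x : E, h (‖x‖ ^ 2) = -∫ s in Ioo ‖x‖ B, 2 * s * g s := fun x =>
    integral_sq_comp_sqrt hg hB hgB (norm_nonneg x)
  have hh0 : ∀ x : E, B ≤ ‖x‖ → h (‖x‖ ^ 2) = 0 := fun x hx => by
    rw [hhr, Ioo_eq_empty (by linarith)]; simp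
  let f : E → ℂ := fun x => ((h (‖x‖ ^ 2) : ℝ) : ℂ)
  let f' : E → ℂ := fun x => ((2 * g ‖x‖ * inner ℝ x k : ℝ) : ℂ)
  have hf' : ∀ x, HasLineDerivAt ℝ f (f' x) x k := fun x => by
    have := hasLineDerivAt_comp_norm_sq (hh (‖x‖ ^ 2)) k
    rwa [Real.sqrt_sq (norm_nonneg x)] at this
  have hfc : Continuous f := by fun_prop
  have hf'c : Continuous f' := by fun_prop
  have hout : ∀ {F : E → ℂ}, (∀ x, B ≤ ‖x‖ → F x = 0) → HasCompactSupport F := fun {F} hF =>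
    HasCompactSupport.intro (isCompact_closedBall (0 : E) B) fun x hx => hF x (by
      simp only [mem_closedBall, dist_zero_right, not_le] at hx; exact hx.le)
  have hfi : Integrable f := hfc.integrable_of_hasCompactSupport (hout fun x hx => by
    simp [f, hh0 x hx])
  have hf'i : Integrable f' := hf'c.integrable_of_hasCompactSupport (hout fun x hx => by
    simp [f', hgB _ hx])
  let u' : E → ℂ := fun x => Complex.I * (inner ℝ k k : ℝ) * planeWave k x
  have hfu' : Integrable fun x => f x * u' x := by
    refine ((hfi.mul_planeWave k).const_mul (Complex.I * (inner ℝ k k : ℝ))).congr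
      (Filter.Eventually.of_forall fun x => ?_)
    simp only [u']; ring
  have hibp := integral_bilinear_hasLineDerivAt_right_eq_neg_left_of_integrable
    (μ := (volume : Measure E)) (f := f) (f' := f') (g := planeWave k) (g' := u') (v := k)
    (B := ContinuousLinearMap.mul ℝ ℂ)
    (hf'i.mul_planeWave k) hfu' (hfi.mul_planeWave k)
    (fun x _ => hf' x) (fun x _ => hasLineDerivAt_planeWave k x k)
  simp only [ContinuousLinearMap.mul_apply'] at hibp
  have hL : ∫ x, f' x * planeWave k x = ∫ r in Ioi (0 : ℝ), ((r ^ (finrank ℝ E - 1) : ℝ) : ℂ) *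
        (((2 * r * g r : ℝ) : ℂ) * sphereFlux k r) := by
    rw [integral_eq_integral_Ioi_toSphere (hf'i.mul_planeWave k)]
    refine setIntegral_congr_fun measurableSet_Ioi fun r (hr : 0 < r) => ?_
    simp only [sphereFlux]
    rw [← integral_const_mul (((2 * r * g r : ℝ) : ℂ))]
    congr 2 with y
    have : ‖(y : E)‖ = 1 := norm_eq_of_mem_sphere y
    simp only [f', norm_smul, this, mul_one, Real.norm_of_nonneg hr.le, real_inner_smul_left]
    rw [real_inner_comm]
    push_cast; ring
  have hw : Measurable fun s => 2 * s * g s := by fun_prop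
  have hwi : IntegrableOn (fun s => s ^ finrank ℝ E * (2 * s * g s)) (Ioo 0 B) :=
    ((by fun_prop : Continuous fun s : ℝ => s ^ finrank ℝ E * (2 * s * g s)).integrableOn_Icc
      (a := 0) (b := B)).mono_set Ioo_subset_Icc_self
  have hR : ∫ x, f x * u' x = -(Complex.I * ((‖k‖ ^ 2 : ℝ) : ℂ) *
      ∫ s in Ioo 0 B, ((2 * s * g s : ℝ) : ℂ) * ballWave k s) := by
    rw [← integral_integral_Ioo_norm_mul_planeWave hw hwi k, ← integral_const_mul, ← integral_neg]
    congr 1 with x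
    simp only [f, u', hhr, real_inner_self_eq_norm_sq]
    push_cast; ring
  rw [hR, hL] at hibp
  exact (neg_injective hibp).symm

/-- The divergence theorem for the field k e^{ik·x} on a single ball, extracted from
`integral_mul_sphereFlux` by the fundamental lemma of the calculus of variations. Almost every
radius suffices, because the identity is only used under an integral in s. -/
theorem ae_sphereFlux_eq [Nontrivial E] (k : E) :
    ∀ᵐ s : ℝ, s ∈ Ioi (0 : ℝ) → ((s ^ (finrank ℝ E - 1) : ℝ) : ℂ) * sphereFlux k s =
      Complex.I * ((‖k‖ ^ 2 : ℝ) : ℂ) * ballWave k s := by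
  let P : ℝ → ℂ := fun s => ((s ^ (finrank ℝ E - 1) : ℝ) : ℂ) * sphereFlux k s
  let Q : ℝ → ℂ := fun s => Complex.I * ((‖k‖ ^ 2 : ℝ) : ℂ) * ballWave k s
  have hP : ∀ A, IntegrableOn P (Ioo 0 A) := fun A => by
    have : Continuous P := by
      have := continuous_sphereFlux k
      fun_prop
    exact this.integrableOn_Icc.mono_set Ioo_subset_Icc_self
  have hQ : ∀ A, IntegrableOn Q (Ioo 0 A) := fun A => (integrableOn_ballWave k A).const_mul _
  have hmul : ∀ {F : ℝ → ℂ}, (∀ A, IntegrableOn F (Ioo 0 A)) → ∀ {w : ℝ → ℝ}, Continuous w →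
      ∀ A, IntegrableOn (fun s => ((w s : ℝ) : ℂ) * F s) (Ioo 0 A) := fun {F} hF {w} hw A => by
    have h1 := (integrableOn_Icc_iff_integrableOn_Ioo (μ := volume)).2 (hF A)
    have hw' : Continuous fun s => ((w s : ℝ) : ℂ) := by fun_prop
    exact (h1.continuousOn_mul hw'.continuousOn isCompact_Icc).mono_set Ioo_subset_Icc_self
  let F : ℝ → ℂ := fun s => ((2 * s : ℝ) : ℂ) * P s - ((2 * s : ℝ) : ℂ) * Q s
  have hF : LocallyIntegrableOn F (Ioi 0) := fun x (hx : 0 < x) =>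
    ⟨Ioo 0 (x + 1), by
      rw [mem_nhdsWithin_iff_exists_mem_nhds_inter]
      exact ⟨Iio (x + 1), Iio_mem_nhds (by linarith), fun s hs => ⟨hs.2, hs.1⟩⟩,
      (hmul hP (by fun_prop) _).sub (hmul hQ (by fun_prop) _)⟩
  have key := isOpen_Ioi.ae_eq_zero_of_integral_contDiff_smul_eq_zero hF fun g hg hgc hgs => by
    obtain ⟨B, hB, hgB⟩ : ∃ B > 0, ∀ r, B ≤ r → g r = 0 := by
      obtain ⟨B, hB⟩ := hgc.isCompact.isBounded.subset_closedBall (0 : ℝ)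
      refine ⟨max B 0 + 1, by positivity, fun r hr => ?_⟩
      by_contra hne
      have := hB (subset_tsupport g (Function.mem_support.2 hne))
      simp only [mem_closedBall, dist_zero_right, Real.norm_eq_abs] at this
      have h1 := le_abs_self r
      have h2 := le_max_left B 0
      linarith
    have hg0 : ∀ r, r ≤ 0 → g r = 0 := fun r hr => by
      by_contra hne
      have : (0 : ℝ) < r := hgs (subset_tsupport g (Function.mem_support.2 hne))
      linarith
    have h1 : ∫ s, g s • F s = ∫ s in Ioo 0 B, g s • F s := by
      refine (setIntegral_eq_integral_of_forall_compl_eq_zero fun s hs => ?_).symm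
      rcases le_or_gt s 0 with h | h
      · rw [hg0 s h, zero_smul]
      · rw [hgB s (not_lt.1 fun h' => hs ⟨h, h'⟩), zero_smul]
    have hgc : Continuous g := hg.continuous
    have h2 := integral_mul_sphereFlux hgc hB hgB k
    rw [setIntegral_eq_of_subset_of_forall_sdiff_eq_zero measurableSet_Ioi
      (s := Ioo 0 B) (fun s hs => hs.1) (fun s hs => by
        rw [hgB s (not_lt.1 fun h' => hs.2 ⟨hs.1, h'⟩)]; simp), ← integral_const_mul] at h2
    have h3 : ∫ s in Ioo 0 B, g s • F s = (∫ s in Ioo 0 B, ((2 * s * g s : ℝ) : ℂ) * P s) -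
        ∫ s in Ioo 0 B, ((2 * s * g s : ℝ) : ℂ) * Q s := by
      rw [← integral_sub (hmul hP (by fun_prop) _) (hmul hQ (by fun_prop) _)]
      congr 1 with s
      simp only [F, Complex.real_smul]
      push_cast; ring
    rw [h1, h3, sub_eq_zero]
    refine (integral_congr_ae (Filter.Eventually.of_forall fun s => ?_)).trans
      (h2.trans (integral_congr_ae (Filter.Eventually.of_forall fun s => ?_)))
    · simp only [P]; ring
    · simp only [Q]; ring
  filter_upwards [key] with s hs hs0
  have h := hs hs0
  have hs0' : (s : ℂ) ≠ 0 := by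
    have : s ≠ 0 := (show (0 : ℝ) < s from hs0).ne'
    exact_mod_cast this
  simp only [F, ← mul_sub] at h
  rcases mul_eq_zero.1 h with h | h
  · push_cast at h
    exact absurd h (mul_ne_zero two_ne_zero hs0')
  · exact sub_eq_zero.1 h

theorem integrableOn_pow_mul_inv_pow {n : ℕ} (hn : 0 < n) (a : ℝ) :
    IntegrableOn (fun s : ℝ => s ^ n * (s ^ (n - 1))⁻¹) (Ioo 0 a) := by
  have h : IntegrableOn (fun s : ℝ => s) (Ioo 0 a) :=
    continuous_id.integrableOn_Icc.mono_set Ioo_subset_Icc_self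
  refine h.congr_fun (fun s hs => ?_) measurableSet_Ioo
  have hs0 : s ^ (n - 1) ≠ 0 := (pow_pos hs.1 _).ne'
  obtain ⟨m, hm⟩ : ∃ m, n = m + 1 := ⟨n - 1, by omega⟩
  simp only [hm, Nat.add_sub_cancel] at hs0 ⊢
  rw [pow_succ', mul_assoc, mul_inv_cancel₀ hs0, mul_one]

/-- The integral of a plane wave over the sphere of radius `r`, with the measure normalised
to that of the unit sphere. -/
def sphereMean (k : E) (r : ℝ) : ℂ :=
  ∫ y : sphere (0 : E) 1, planeWave k (r • (y : E)) ∂(volume : Measure E).toSphere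

/-- The fundamental theorem of calculus along each ray, then Fubini for a bounded integrand. -/
theorem sphereMean_sub (k : E) {a : ℝ} (ha : 0 ≤ a) :
    sphereMean k a - sphereMean k 0 = Complex.I * ∫ r in Ioo 0 a, sphereFlux k r := by
  have hbd : ∀ y : sphere (0 : E) 1, ‖(inner ℝ k (y : E) : ℝ)‖ ≤ ‖k‖ := fun y => by
    have h := norm_inner_le_norm (𝕜 := ℝ) k (y : E)
    have : ‖(y : E)‖ = 1 := norm_eq_of_mem_sphere y
    rwa [this, mul_one] at h
  have hc : ∀ r : ℝ, Continuous fun y : sphere (0 : E) 1 => planeWave k (r • (y : E)) := fun r => by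
    unfold planeWave; fun_prop
  have hi : ∀ r : ℝ, Integrable (fun y : sphere (0 : E) 1 => planeWave k (r • (y : E)))
      (volume : Measure E).toSphere := fun r =>
    Integrable.of_bound (hc r).aestronglyMeasurable 1
      (Filter.Eventually.of_forall fun y => (norm_planeWave _ _).le)
  have hftc : ∀ y : sphere (0 : E) 1, planeWave k (a • (y : E)) - planeWave k ((0 : ℝ) • (y : E)) =
      ∫ r in Ioo 0 a, Complex.I * (((inner ℝ k (y : E) : ℝ) : ℂ) * planeWave k (r • (y : E))) := by
    intro y
    rw [← intervalIntegral.integral_eq_sub_of_hasDerivAt (a := 0) (b := a)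
      (fun r _ => hasDerivAt_planeWave_smul k (y : E) r), intervalIntegral.integral_of_le ha,
      integral_Ioc_eq_integral_Ioo]
    · simp_rw [mul_assoc]
    · refine Continuous.intervalIntegrable ?_ _ _
      unfold planeWave; fun_prop
  simp only [sphereMean, sphereFlux]
  rw [← integral_sub (hi a) (hi 0), ← integral_const_mul]
  simp_rw [hftc, ← integral_const_mul]
  rw [integral_integral_swap]
  refine Integrable.of_bound (C := ‖k‖) ?_ (Filter.Eventually.of_forall fun p => ?_)
  · refine Continuous.aestronglyMeasurable ?_
    unfold Function.uncurry planeWave; fun_prop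
  · simp only [Function.uncurry, norm_mul, Complex.norm_I, one_mul, norm_planeWave, mul_one,
      Complex.norm_real]
    exact hbd p.1

/-- By `ae_sphereFlux_eq`, the radial derivative i · `sphereFlux k s` of the spherical integral is
-‖k‖² s^{1-n} `ballWave k s`, with n the dimension, so the integral telescopes. -/
theorem normSq_mul_integral_ballWave [Nontrivial E] (k : E) {a : ℝ} (ha : 0 ≤ a) :
    ((‖k‖ ^ 2 : ℝ) : ℂ) * ∫ s in Ioo 0 a, (((s ^ (finrank ℝ E - 1))⁻¹ : ℝ) : ℂ) * ballWave k s =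
      sphereMean k 0 - sphereMean k a := by
  have h1 : ∫ s in Ioo 0 a, sphereFlux k s = Complex.I * (((‖k‖ ^ 2 : ℝ) : ℂ) *
      ∫ s in Ioo 0 a, (((s ^ (finrank ℝ E - 1))⁻¹ : ℝ) : ℂ) * ballWave k s) := by
    rw [← integral_const_mul, ← integral_const_mul]
    refine setIntegral_congr_ae measurableSet_Ioo ?_
    filter_upwards [ae_sphereFlux_eq k] with s hs hs0
    have h := hs hs0.1
    have hs1 : ((s ^ (finrank ℝ E - 1) : ℝ) : ℂ) ≠ 0 := by
      exact_mod_cast (pow_pos hs0.1 _).ne'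
    rw [Complex.ofReal_inv]
    calc sphereFlux k s = (((s ^ (finrank ℝ E - 1) : ℝ) : ℂ))⁻¹ *
          (((s ^ (finrank ℝ E - 1) : ℝ) : ℂ) * sphereFlux k s) := by
          rw [← mul_assoc, inv_mul_cancel₀ hs1, one_mul]
      _ = _ := by rw [h]; ring
  have h2 := sphereMean_sub k ha
  rw [h1, ← mul_assoc, Complex.I_mul_I] at h2
  linear_combination h2

/-- The Fourier transform of `x ↦ ∫_{|x|}^a s^{1-d} ds`. -/
theorem normSq_mul_integral_planeWave [Nontrivial E] (k : E) {a : ℝ} (ha : 0 ≤ a) :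
    ((‖k‖ ^ 2 : ℝ) : ℂ) * ∫ x : E, ((∫ s in Ioo ‖x‖ a, (s ^ (finrank ℝ E - 1))⁻¹ : ℝ) : ℂ) *
      planeWave k x = sphereMean k 0 - sphereMean k a := by
  rw [← normSq_mul_integral_ballWave k ha, integral_integral_Ioo_norm_mul_planeWave (by fun_prop)
    (integrableOn_pow_mul_inv_pow finrank_pos a)]

end BallSphere

end CutoffGreen

end

noncomputable section

namespace CutoffGreen

/-! ### One-dimensional integrals: Euler's constant and Γ(1/2) -/

section OneDim

open Set Filter Topology

theorem integrableOn_log_mul_exp_neg :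
    IntegrableOn (fun t => Real.log t * Real.exp (-t)) (Ioi 0) := by
  rw [← Ioc_union_Ioi_eq_Ioi (zero_le_one' ℝ), integrableOn_union]
  constructor
  · have h := intervalIntegral.intervalIntegrable_log' (a := 0) (b := 1)
    rw [intervalIntegrable_iff_integrableOn_Ioc_of_le zero_le_one] at h
    refine h.mul_bdd (c := 1) (by fun_prop) ?_
    refine (ae_restrict_iff' measurableSet_Ioc).2 (Eventually.of_forall fun t ht => ?_)
    rw [Real.norm_of_nonneg (Real.exp_pos _).le]
    exact Real.exp_le_one_iff.2 (by linarith [ht.1])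
  · have h := (Real.GammaIntegral_convergent (s := 2) (by norm_num)).mono_set
      (Ioi_subset_Ioi (zero_le_one' ℝ))
    refine h.mono' (by fun_prop) ?_
    refine (ae_restrict_iff' measurableSet_Ioi).2 (Eventually.of_forall fun t (ht : 1 < t) => ?_)
    have h1 : 0 ≤ Real.log t := Real.log_nonneg ht.le
    have h2 : Real.log t ≤ t := by linarith [Real.log_le_sub_one_of_pos (by linarith : 0 < t)]
    rw [Real.norm_of_nonneg (by positivity), mul_comm]
    norm_num
    gcongr

/-- Differentiating Euler's integral under the integral sign gives Γ'(1), which is -γ. -/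
theorem integral_log_mul_exp_neg :
    ∫ t in Ioi (0 : ℝ), Real.log t * Real.exp (-t) = -Real.eulerMascheroniConstant := by
  have h1 := Complex.hasDerivAt_GammaIntegral (s := 1) (by simp)
  have h2 : HasDerivAt Complex.GammaIntegral (-Real.eulerMascheroniConstant : ℂ) 1 := by
    refine Complex.hasDerivAt_Gamma_one.congr_of_eventuallyEq ?_
    have : {z : ℂ | 0 < z.re} ∈ 𝓝 (1 : ℂ) :=
      (isOpen_lt continuous_const Complex.continuous_re).mem_nhds (by simp)
    filter_upwards [this] with z hz
    exact (Complex.Gamma_eq_integral hz).symm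
  have h3 := h1.unique h2
  simp only [sub_self, Complex.cpow_zero, one_mul] at h3
  have h4 : ((∫ t in Ioi (0 : ℝ), Real.log t * Real.exp (-t) : ℝ) : ℂ) =
      ((-Real.eulerMascheroniConstant : ℝ) : ℂ) := by
    rw [← integral_complex_ofReal]
    simp only [Complex.ofReal_mul, Complex.ofReal_neg]
    exact h3
  exact_mod_cast h4

theorem abs_exp_neg_sub_one_le {s : ℝ} (hs : 0 ≤ s) : |Real.exp (-s) - 1| ≤ s := by
  rw [abs_sub_comm, abs_of_nonneg (by linarith [Real.exp_le_one_iff.2 (by linarith : -s ≤ 0)])]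
  linarith [Real.add_one_le_exp (-s)]

theorem intervalIntegrable_exp_neg_sub_one_div {B : ℝ} (hB : 0 ≤ B) :
    IntervalIntegrable (fun s => (Real.exp (-s) - 1) / s) volume 0 B := by
  rw [intervalIntegrable_iff_integrableOn_Ioc_of_le hB]
  refine Measure.integrableOn_of_bounded (M := 1) (by simp)
    (by fun_prop : Measurable _).aestronglyMeasurable ?_
  refine (ae_restrict_iff' measurableSet_Ioc).2 (Eventually.of_forall fun t ht => ?_)
  rw [norm_div, Real.norm_eq_abs, Real.norm_of_nonneg ht.1.le, div_le_one ht.1]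
  exact abs_exp_neg_sub_one_le ht.1.le

theorem integrableOn_Ioi_exp_neg_div {B : ℝ} (hB : 0 < B) :
    IntegrableOn (fun s => Real.exp (-s) / s) (Ioi B) := by
  refine ((exp_neg_integrableOn_Ioi B one_pos).div_const B).mono'
    (by fun_prop : Measurable _).aestronglyMeasurable ?_
  refine (ae_restrict_iff' measurableSet_Ioi).2 (Eventually.of_forall fun t (ht : B < t) => ?_)
  have : 0 < t := hB.trans ht
  rw [Real.norm_of_nonneg (by positivity), neg_one_mul]
  gcongr

/-- Integration by parts with e^{-s} - 1 in place of e^{-s}, so that the boundary term at 0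
vanishes. -/
theorem integral_exp_neg_sub_one_div {B : ℝ} (hB : 0 < B) :
    ∫ s in (0 : ℝ)..B, (Real.exp (-s) - 1) / s =
      Real.log B * (Real.exp (-B) - 1) + ∫ s in (0 : ℝ)..B, Real.log s * Real.exp (-s) := by
  have hi1 := intervalIntegrable_exp_neg_sub_one_div hB.le
  have hi2 : IntervalIntegrable (fun s => Real.log s * Real.exp (-s)) volume 0 B := by
    rw [intervalIntegrable_iff_integrableOn_Ioc_of_le hB.le]
    exact integrableOn_log_mul_exp_neg.mono_set Ioc_subset_Ioi_self
  have h := intervalIntegral.integral_eq_sub_of_hasDerivAt_of_tendsto hB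
    (f := fun s => Real.log s * (Real.exp (-s) - 1))
    (f' := fun s => (Real.exp (-s) - 1) / s - Real.log s * Real.exp (-s)) (fa := 0)
    (fb := Real.log B * (Real.exp (-B) - 1)) (fun s hs => ?_) (hi1.sub hi2) ?_ ?_
  · rw [intervalIntegral.integral_sub hi1 hi2] at h
    linarith
  · have h1 := (Real.hasDerivAt_log hs.1.ne').mul ((hasDerivAt_neg s).exp.sub_const 1)
    refine h1.congr_deriv ?_
    ring
  · have h0 : Tendsto (fun s : ℝ => Real.log s * s) (𝓝[>] 0) (𝓝 0) := by
      simpa using tendsto_log_mul_rpow_nhdsGT_zero (r := 1) one_pos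
    have h0' : Tendsto (fun s : ℝ => |Real.log s * s|) (𝓝[>] 0) (𝓝 0) := by
      simpa using h0.abs
    refine squeeze_zero_norm' ?_ h0'
    filter_upwards [self_mem_nhdsWithin] with s (hs : 0 < s)
    rw [norm_mul, abs_mul, Real.norm_eq_abs, Real.norm_eq_abs, abs_of_pos hs]
    gcongr
    exact abs_exp_neg_sub_one_le hs.le
  · have : ContinuousAt (fun s => Real.log s * (Real.exp (-s) - 1)) B :=
      (Real.continuousAt_log hB.ne').mul (by fun_prop)
    exact this.tendsto.mono_left nhdsWithin_le_nhds

theorem integral_Ioi_exp_neg_div {B : ℝ} (hB : 0 < B) :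
    ∫ s in Ioi B, Real.exp (-s) / s =
      -(Real.log B * Real.exp (-B)) + ∫ s in Ioi B, Real.log s * Real.exp (-s) := by
  have hi1 := integrableOn_Ioi_exp_neg_div hB
  have hi2 := integrableOn_log_mul_exp_neg.mono_set (Ioi_subset_Ioi hB.le)
  have h := integral_Ioi_of_hasDerivAt_of_tendsto' (a := B) (m := 0)
    (f := fun s => Real.log s * Real.exp (-s))
    (f' := fun s => Real.exp (-s) / s - Real.log s * Real.exp (-s)) (fun s hs => ?_)
    (hi1.sub hi2) ?_
  · rw [integral_sub hi1 hi2] at h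
    linarith
  · have hs0 : 0 < s := hB.trans_le hs
    have h1 := (Real.hasDerivAt_log hs0.ne').mul (hasDerivAt_neg s).exp
    refine h1.congr_deriv ?_
    ring
  · have h0 : Tendsto (fun s : ℝ => s ^ 1 * Real.exp (-s)) atTop (𝓝 0) :=
      Real.tendsto_pow_mul_exp_neg_atTop_nhds_zero 1
    refine squeeze_zero_norm' ?_ h0
    filter_upwards [eventually_ge_atTop 1] with s hs
    have h1 : 0 ≤ Real.log s := Real.log_nonneg hs
    have h2 : Real.log s ≤ s := by linarith [Real.log_le_sub_one_of_pos (by linarith : 0 < s)]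
    rw [Real.norm_of_nonneg (by positivity), pow_one]
    gcongr

theorem integrableOn_exp_neg_sub_indicator_div {B : ℝ} (hB : 0 < B) :
    IntegrableOn (fun s => (Real.exp (-s) - if s < B then 1 else 0) / s) (Ioi 0) := by
  rw [← Ioo_union_Ici_eq_Ioi hB, integrableOn_union, integrableOn_Ici_iff_integrableOn_Ioi]
  constructor
  · have h := intervalIntegrable_exp_neg_sub_one_div hB.le
    rw [intervalIntegrable_iff_integrableOn_Ioo_of_le hB.le] at h
    exact h.congr_fun (fun s hs => by simp [hs.2]) measurableSet_Ioo
  · exact (integrableOn_Ioi_exp_neg_div hB).congr_fun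
      (fun s (hs : B < s) => by simp [not_lt.2 hs.le]) measurableSet_Ioi

/-- Integrating by parts on both sides of `B`, the boundary terms add up to -log B and the
logarithmic integrals to -γ. -/
theorem integral_exp_neg_sub_indicator_div {B : ℝ} (hB : 0 < B) :
    ∫ s in Ioi 0, (Real.exp (-s) - if s < B then 1 else 0) / s =
      -Real.eulerMascheroniConstant - Real.log B := by
  have hi := integrableOn_exp_neg_sub_indicator_div hB
  have h1 : ∫ s in Ioo 0 B, (Real.exp (-s) - if s < B then 1 else 0) / s =
      ∫ s in (0 : ℝ)..B, (Real.exp (-s) - 1) / s := by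
    rw [intervalIntegral.integral_of_le hB.le, integral_Ioc_eq_integral_Ioo]
    exact setIntegral_congr_fun measurableSet_Ioo fun s hs => by simp [hs.2]
  have h2 : ∫ s in Ici B, (Real.exp (-s) - if s < B then 1 else 0) / s =
      ∫ s in Ioi B, Real.exp (-s) / s := by
    rw [integral_Ici_eq_integral_Ioi]
    exact setIntegral_congr_fun measurableSet_Ioi fun s (hs : B < s) => by simp [not_lt.2 hs.le]
  have hl := integrableOn_log_mul_exp_neg
  have h3 : (∫ s in (0 : ℝ)..B, Real.log s * Real.exp (-s)) +
      ∫ s in Ioi B, Real.log s * Real.exp (-s) = -Real.eulerMascheroniConstant := by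
    rw [← integral_log_mul_exp_neg, ← Ioc_union_Ioi_eq_Ioi hB.le,
      setIntegral_union Ioc_disjoint_Ioi_same measurableSet_Ioi
        (hl.mono_set Ioc_subset_Ioi_self) (hl.mono_set (Ioi_subset_Ioi hB.le)),
      intervalIntegral.integral_of_le hB.le]
  rw [← Ioo_union_Ici_eq_Ioi hB] at hi ⊢
  rw [setIntegral_union (by
    rw [Set.disjoint_left]; intro s hs hs'; exact absurd hs.2 (not_lt.2 hs')) measurableSet_Ici
    hi.left_of_union hi.right_of_union, h1, h2, integral_exp_neg_sub_one_div hB,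
    integral_Ioi_exp_neg_div hB]
  linear_combination h3

theorem integral_exp_neg_mul_sub_indicator_div {A : ℝ} (hA : 0 < A) :
    ∫ s in Ioi 0, (Real.exp (-(A * s)) - if s < 1 then 1 else 0) / s =
      -Real.eulerMascheroniConstant - Real.log A := by
  rw [← integral_exp_neg_sub_indicator_div hA]
  have h := integral_comp_mul_left_Ioi'
    (fun s : ℝ => (Real.exp (-s) - if s < A then 1 else 0) / s) 0 hA
  rw [mul_zero] at h
  rw [← h, ← integral_smul]
  refine setIntegral_congr_fun measurableSet_Ioi fun s (hs : 0 < s) => ?_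
  have : (A * s < A) ↔ s < 1 := by
    constructor <;> intro h <;> nlinarith
  simp only [this, smul_eq_mul]
  field_simp

theorem integrableOn_rpow_mul_exp_neg_sub_one {A : ℝ} (hA : 0 < A) :
    IntegrableOn (fun s : ℝ => s ^ (-(3 / 2) : ℝ) * (Real.exp (-(A * s)) - 1)) (Ioi 0) := by
  have hm : Measurable (fun s : ℝ => s ^ (-(3 / 2) : ℝ) * (Real.exp (-(A * s)) - 1)) := by fun_prop
  rw [← Ioc_union_Ioi_eq_Ioi (zero_le_one' ℝ), integrableOn_union]
  constructor
  · have h := intervalIntegral.intervalIntegrable_rpow' (a := 0) (b := 1) (r := (-(1 / 2) : ℝ))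
      (by norm_num)
    rw [intervalIntegrable_iff_integrableOn_Ioc_of_le zero_le_one] at h
    refine (h.const_mul A).mono' hm.aestronglyMeasurable ?_
    refine (ae_restrict_iff' measurableSet_Ioc).2 (Eventually.of_forall fun s hs => ?_)
    have hs0 : 0 < s := hs.1
    rw [norm_mul, Real.norm_of_nonneg (by positivity), Real.norm_eq_abs]
    calc s ^ (-(3 / 2) : ℝ) * |Real.exp (-(A * s)) - 1| ≤ s ^ (-(3 / 2) : ℝ) * (A * s) := by
          gcongr; exact abs_exp_neg_sub_one_le (by positivity)
      _ = A * (s ^ (-(3 / 2) : ℝ) * s ^ (1 : ℝ)) := by rw [Real.rpow_one]; ring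
      _ = A * s ^ (-(1 / 2) : ℝ) := by rw [← Real.rpow_add hs0]; norm_num
  · refine (integrableOn_Ioi_rpow_of_lt (a := (-(3 / 2) : ℝ)) (by norm_num) one_pos).mono'
      hm.aestronglyMeasurable ?_
    refine (ae_restrict_iff' measurableSet_Ioi).2 (Eventually.of_forall fun s (hs : 1 < s) => ?_)
    have hs0 : 0 < s := by linarith
    rw [norm_mul, Real.norm_of_nonneg (by positivity), Real.norm_eq_abs]
    refine mul_le_of_le_one_right (by positivity) ?_
    have h1 := Real.exp_pos (-(A * s))
    have h2 : Real.exp (-(A * s)) ≤ 1 := Real.exp_le_one_iff.2 (by nlinarith)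
    rw [abs_le]; constructor <;> linarith

/-- Integration by parts raises the exponent from -3/2 to -1/2, which leaves the integral for Γ(1/2)
= √π. -/
theorem integral_rpow_mul_exp_neg_sub_one {A : ℝ} (hA : 0 < A) :
    ∫ s in Ioi (0 : ℝ), s ^ (-(3 / 2) : ℝ) * (Real.exp (-(A * s)) - 1) = -2 * √(Real.pi * A) := by
  have hi1 := integrableOn_rpow_mul_exp_neg_sub_one hA
  have hi2 : IntegrableOn (fun s : ℝ => s ^ ((1 / 2 : ℝ) - 1) * Real.exp (-(A * s))) (Ioi 0) := by
    have := integrableOn_rpow_mul_exp_neg_mul_rpow (p := 1) (s := (1 / 2 : ℝ) - 1) (b := A)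
      (by norm_num) one_pos hA
    simpa using this
  have hg := Real.integral_rpow_mul_exp_neg_mul_Ioi (a := 1 / 2) (by norm_num) hA
  have h := integral_Ioi_of_hasDerivAt_of_tendsto (a := 0) (m := 0)
    (f := fun s : ℝ => -2 * (s ^ (-(1 / 2) : ℝ) * (Real.exp (-(A * s)) - 1)))
    (f' := fun s : ℝ => s ^ (-(3 / 2) : ℝ) * (Real.exp (-(A * s)) - 1) +
      2 * A * (s ^ ((1 / 2 : ℝ) - 1) * Real.exp (-(A * s)))) ?_ (fun s (hs : 0 < s) => ?_)
    (hi1.add (hi2.const_mul _)) ?_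
  · rw [integral_add hi1 (hi2.const_mul _), integral_const_mul, hg] at h
    have h2 : (1 / A) ^ (1 / 2 : ℝ) * A = √A := by
      rw [← Real.sqrt_eq_rpow, Real.sqrt_div zero_le_one, Real.sqrt_one]
      have : √A ≠ 0 := (Real.sqrt_pos.2 hA).ne'
      field_simp
      rw [Real.sq_sqrt hA.le]
    rw [Real.Gamma_one_half_eq] at h
    simp only [mul_zero, neg_zero, Real.exp_zero, sub_self] at h
    rw [Real.sqrt_mul Real.pi_pos.le]
    linear_combination h - 2 * √Real.pi * h2
  · rw [ContinuousWithinAt]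
    simp only [mul_zero, neg_zero, Real.exp_zero, sub_self]
    have h0 : Tendsto (fun s : ℝ => 2 * A * s ^ (1 / 2 : ℝ)) (𝓝[≥] 0) (𝓝 0) := by
      have : Continuous (fun s : ℝ => 2 * A * s ^ (1 / 2 : ℝ)) :=
        continuous_const.mul (Real.continuous_rpow_const (by norm_num))
      have h := this.tendsto 0
      rw [Real.zero_rpow (by norm_num), mul_zero] at h
      exact h.mono_left nhdsWithin_le_nhds
    refine squeeze_zero_norm' ?_ h0
    filter_upwards [self_mem_nhdsWithin] with s (hs : 0 ≤ s)
    rcases hs.eq_or_lt with rfl | hs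
    · simp
    rw [norm_mul, norm_mul, Real.norm_of_nonneg (by positivity : 0 ≤ s ^ (-(1 / 2) : ℝ)),
      Real.norm_eq_abs, Real.norm_eq_abs]
    calc |(-2 : ℝ)| * (s ^ (-(1 / 2) : ℝ) * |Real.exp (-(A * s)) - 1|)
        ≤ 2 * (s ^ (-(1 / 2) : ℝ) * (A * s)) := by
          rw [abs_neg, abs_two]
          gcongr; exact abs_exp_neg_sub_one_le (by positivity)
      _ = 2 * A * (s ^ (-(1 / 2) : ℝ) * s ^ (1 : ℝ)) := by rw [Real.rpow_one]; ring
      _ = 2 * A * s ^ (1 / 2 : ℝ) := by rw [← Real.rpow_add hs]; norm_num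
  · have h1 := Real.hasDerivAt_rpow_const (x := s) (p := (-(1 / 2) : ℝ)) (Or.inl hs.ne')
    have h2 : HasDerivAt (fun s : ℝ => Real.exp (-(A * s)) - 1)
        (Real.exp (-(A * s)) * -(A * 1)) s :=
      (((hasDerivAt_id s).const_mul A).neg.exp).sub_const 1
    have h3 := (h1.mul h2).const_mul (-2)
    refine h3.congr_deriv ?_
    have e1 : (-(1 / 2) - 1 : ℝ) = -(3 / 2) := by norm_num
    have e2 : (1 / 2 - 1 : ℝ) = -(1 / 2) := by norm_num
    rw [e1, e2]
    ring
  · have h0 : Tendsto (fun s : ℝ => 2 * s ^ (-(1 / 2) : ℝ)) atTop (𝓝 0) := by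
      simpa using (tendsto_rpow_neg_atTop (y := 1 / 2) (by norm_num)).const_mul 2
    refine squeeze_zero_norm' ?_ h0
    filter_upwards [eventually_gt_atTop 0] with s hs
    rw [norm_mul, norm_mul, Real.norm_of_nonneg (by positivity : 0 ≤ s ^ (-(1 / 2) : ℝ)),
      Real.norm_eq_abs, Real.norm_eq_abs, abs_neg, abs_two]
    have h1 := Real.exp_pos (-(A * s))
    have h2 : Real.exp (-(A * s)) ≤ 1 := Real.exp_le_one_iff.2 (by nlinarith)
    have h3 : |Real.exp (-(A * s)) - 1| ≤ 1 := by
      rw [abs_le]; constructor <;> linarith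
    have h4 : 0 ≤ s ^ (-(1 / 2) : ℝ) := by positivity
    nlinarith

end OneDim

end CutoffGreen

end

noncomputable section

namespace CutoffGreen

/-! ### The Green function as a regularised time integral of the heat kernel -/

section Heat

open Set Filter Topology

/-- The heat kernel of `ℝᵈ` as a function of the radius. -/
def heat (d : ℕ) (t r : ℝ) : ℝ := (4 * Real.pi * t) ^ (-((d : ℝ) / 2)) * Real.exp (-(r ^ 2 / (4 * t)))

/-- The weight with which the value at the origin is subtracted from the heat kernel, to make
its time integral converge. -/
def heatWeight (d : ℕ) (t : ℝ) : ℝ := if d = 1 then 1 else if d = 2 then (if 1 < t then 1 else 0) else 0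

/-- The difference between the regularised time integral of the heat kernel and `green`. -/
def heatConst (d : ℕ) : ℝ :=
  if d = 2 then (2 * Real.log 2 - Real.eulerMascheroniConstant) / (4 * Real.pi) else 0

theorem heat_nonneg {d : ℕ} {t r : ℝ} (ht : 0 < t) : 0 ≤ heat d t r := by
  have := Real.pi_pos
  unfold heat; positivity

theorem heat_zero (d : ℕ) (t : ℝ) : heat d t 0 = (4 * Real.pi * t) ^ (-((d : ℝ) / 2)) := by
  simp [heat]

theorem heat_inv (d : ℕ) {s : ℝ} (hs : 0 < s) (r : ℝ) :
    heat d s⁻¹ r = (4 * Real.pi) ^ (-((d : ℝ) / 2)) * s ^ ((d : ℝ) / 2) *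
      Real.exp (-(r ^ 2 / 4 * s)) := by
  have hpi := Real.pi_pos
  rw [heat, Real.mul_rpow (by positivity) (by positivity), Real.inv_rpow hs.le, Real.rpow_neg hs.le,
    inv_inv]
  congr 3
  field_simp

/-- The change of variable s = 1/t, which makes the heat kernel a power of s times an exponential.
-/
theorem integral_Ioi_inv (g : ℝ → ℝ) :
    ∫ t in Ioi 0, g t = ∫ s in Ioi 0, (s ^ 2)⁻¹ * g s⁻¹ := by
  rw [← integral_comp_rpow_Ioi g (p := -1) (by norm_num)]
  refine setIntegral_congr_fun measurableSet_Ioi fun s (hs : 0 < s) => ?_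
  have e : (-1 - 1 : ℝ) = -(2 : ℕ) := by norm_num
  simp only [abs_neg, abs_one, one_mul, smul_eq_mul]
  rw [e, Real.rpow_neg hs.le, Real.rpow_natCast, Real.rpow_neg_one]

theorem sphereArea_one : sphereArea 1 = 2 := by
  have : (0 : ℝ) < √Real.pi := Real.sqrt_pos.2 Real.pi_pos
  simp only [sphereArea, Nat.cast_one, Real.Gamma_one_half_eq, ← Real.sqrt_eq_rpow]
  field_simp

theorem sphereArea_two : sphereArea 2 = 2 * Real.pi := by simp [sphereArea]

theorem sphereArea_pos {d : ℕ} (hd : 1 ≤ d) : 0 < sphereArea d := by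
  have hd' : (0 : ℝ) < d := by exact_mod_cast hd
  have := Real.Gamma_pos_of_pos (show (0 : ℝ) < d / 2 by positivity)
  have := Real.pi_pos
  unfold sphereArea; positivity

theorem integral_heat_one {r : ℝ} (hr : 0 < r) :
    ∫ t in Ioi 0, (heat 1 t r - heatWeight 1 t * heat 1 t 0) = -r / 2 := by
  have hpi := Real.pi_pos
  rw [integral_Ioi_inv]
  have : ∀ s ∈ Ioi (0 : ℝ), (s ^ 2)⁻¹ * (heat 1 s⁻¹ r - heatWeight 1 s⁻¹ * heat 1 s⁻¹ 0) =
      (4 * Real.pi) ^ (-(1 / 2) : ℝ) * (s ^ (-(3 / 2) : ℝ) * (Real.exp (-(r ^ 2 / 4 * s)) - 1)) := by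
    intro s (hs : 0 < s)
    rw [heat_inv 1 hs, heat_inv 1 hs]
    have e : s ^ (-(3 / 2) : ℝ) = (s ^ 2)⁻¹ * s ^ (1 / 2 : ℝ) := by
      rw [← Real.rpow_natCast, ← Real.rpow_neg hs.le, ← Real.rpow_add hs]; norm_num
    rw [e]
    simp only [heatWeight, if_true, Nat.cast_one]
    norm_num
    ring
  rw [setIntegral_congr_fun measurableSet_Ioi this, integral_const_mul,
    integral_rpow_mul_exp_neg_sub_one (by positivity), Real.rpow_neg (by positivity),
    ← Real.sqrt_eq_rpow]
  have e1 : √(4 * Real.pi) = 2 * √Real.pi := by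
    rw [Real.sqrt_mul (by norm_num), show (4 : ℝ) = 2 ^ 2 by norm_num, Real.sqrt_sq (by norm_num)]
  have e2 : √(Real.pi * (r ^ 2 / 4)) = √Real.pi * (r / 2) := by
    rw [Real.sqrt_mul hpi.le, show r ^ 2 / 4 = (r / 2) ^ 2 by ring, Real.sqrt_sq (by positivity)]
  rw [e1, e2]
  have : √Real.pi ≠ 0 := (Real.sqrt_pos.2 hpi).ne'
  field_simp

/-- After s = 1/t this is (4π)⁻¹ (-γ - log(r²/4)), whose part independent of r is `heatConst 2`. -/
theorem integral_heat_two {r : ℝ} (hr : 0 < r) :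
    ∫ t in Ioi 0, (heat 2 t r - heatWeight 2 t * heat 2 t 0) =
      -Real.log r / (2 * Real.pi) +
        (2 * Real.log 2 - Real.eulerMascheroniConstant) / (4 * Real.pi) := by
  have hpi := Real.pi_pos
  rw [integral_Ioi_inv]
  have : ∀ s ∈ Ioi (0 : ℝ), (s ^ 2)⁻¹ * (heat 2 s⁻¹ r - heatWeight 2 s⁻¹ * heat 2 s⁻¹ 0) =
      (4 * Real.pi)⁻¹ * ((Real.exp (-(r ^ 2 / 4 * s)) - if s < 1 then 1 else 0) / s) := by
    intro s (hs : 0 < s)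
    rw [heat_inv 2 hs, heat_inv 2 hs]
    have h1 : 1 < s⁻¹ ↔ s < 1 := one_lt_inv₀ hs
    simp only [heatWeight, h1, Nat.cast_ofNat, div_self (two_ne_zero' ℝ), Real.rpow_neg_one,
      Real.rpow_one]
    split_ifs <;> first | contradiction | (field_simp; norm_num)
  rw [setIntegral_congr_fun measurableSet_Ioi this, integral_const_mul,
    integral_exp_neg_mul_sub_indicator_div (by positivity), Real.log_div (by positivity)
    (by norm_num), Real.log_pow, show (4 : ℝ) = 2 ^ 2 by norm_num, Real.log_pow]
  field_simp
  push_cast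
  ring

/-- After s = 1/t this is a Gamma integral; Γ(d/2) = (d/2 - 1) Γ(d/2 - 1) produces the factor (d -
2) S. -/
theorem integral_heat_of_three_le {d : ℕ} (hd : 3 ≤ d) {r : ℝ} (hr : 0 < r) :
    ∫ t in Ioi 0, (heat d t r - heatWeight d t * heat d t 0) =
      r ^ (2 - (d : ℤ)) / (((d : ℝ) - 2) * sphereArea d) := by
  have hpi := Real.pi_pos
  have hd' : (3 : ℝ) ≤ d := by exact_mod_cast hd
  rw [integral_Ioi_inv]
  have : ∀ s ∈ Ioi (0 : ℝ), (s ^ 2)⁻¹ * (heat d s⁻¹ r - heatWeight d s⁻¹ * heat d s⁻¹ 0) =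
      (4 * Real.pi) ^ (-((d : ℝ) / 2)) *
        (s ^ (((d : ℝ) / 2 - 1) - 1) * Real.exp (-(r ^ 2 / 4 * s))) := by
    intro s (hs : 0 < s)
    have e : s ^ (((d : ℝ) / 2 - 1) - 1) = (s ^ 2)⁻¹ * s ^ ((d : ℝ) / 2) := by
      rw [← Real.rpow_natCast, ← Real.rpow_neg hs.le, ← Real.rpow_add hs]
      congr 1; push_cast; ring
    have h1 : d ≠ 1 := by omega
    have h2 : d ≠ 2 := by omega
    rw [heat_inv d hs, e]
    simp only [heatWeight, h1, h2, if_false]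
    ring
  rw [setIntegral_congr_fun measurableSet_Ioi this, integral_const_mul,
    Real.integral_rpow_mul_exp_neg_mul_Ioi (by linarith) (by positivity)]
  have hG : Real.Gamma ((d : ℝ) / 2) = ((d : ℝ) / 2 - 1) * Real.Gamma ((d : ℝ) / 2 - 1) := by
    rw [← Real.Gamma_add_one (by linarith)]; congr 1; ring
  have hGpos : 0 < Real.Gamma ((d : ℝ) / 2 - 1) := Real.Gamma_pos_of_pos (by linarith)
  have hr2 : (1 / (r ^ 2 / 4)) ^ ((d : ℝ) / 2 - 1) = 2 ^ ((d : ℝ) - 2) * r ^ (2 - (d : ℝ)) := by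
    rw [show 1 / (r ^ 2 / 4) = (2 / r) ^ (2 : ℝ) by rw [Real.rpow_two]; field_simp; norm_num,
      ← Real.rpow_mul (by positivity), show (2 : ℝ) * ((d : ℝ) / 2 - 1) = d - 2 by ring,
      Real.div_rpow (by norm_num) hr.le, show 2 - (d : ℝ) = -((d : ℝ) - 2) by ring,
      Real.rpow_neg hr.le]
    rfl
  have h4 : (4 * Real.pi) ^ (-((d : ℝ) / 2)) = (2 ^ (d : ℝ))⁻¹ * (Real.pi ^ ((d : ℝ) / 2))⁻¹ := by
    rw [Real.rpow_neg (by positivity), Real.mul_rpow (by norm_num) hpi.le, mul_inv,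
      show (4 : ℝ) = 2 ^ (2 : ℝ) by norm_num, ← Real.rpow_mul (by norm_num)]
    congr 3; ring
  have hz : r ^ (2 - (d : ℤ)) = r ^ (2 - (d : ℝ)) := by
    rw [← Real.rpow_intCast]; push_cast; rfl
  have h22 : (2 : ℝ) ^ ((d : ℝ) - 2) = 2 ^ (d : ℝ) / 4 := by
    rw [Real.rpow_sub (by norm_num)]; norm_num
  have p1 : (0 : ℝ) < 2 ^ (d : ℝ) := by positivity
  have p2 : 0 < Real.pi ^ ((d : ℝ) / 2) := by positivity
  rw [hr2, h4, hz, sphereArea, hG, h22]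
  have hd2 : (d : ℝ) - 2 ≠ 0 := by linarith
  have hd3 : (d : ℝ) / 2 - 1 ≠ 0 := by linarith
  field_simp
  ring

/-- `green` is the regularised time integral of the heat kernel. -/
theorem integral_heat {d : ℕ} (hd : 1 ≤ d) {r : ℝ} (hr : 0 < r) :
    ∫ t in Ioi 0, (heat d t r - heatWeight d t * heat d t 0) = green d r + heatConst d := by
  obtain rfl | rfl | hd : d = 1 ∨ d = 2 ∨ 3 ≤ d := by omega
  · rw [integral_heat_one hr]; simp [green, heatConst]
  · rw [integral_heat_two hr]; simp [green, heatConst]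
  · rw [integral_heat_of_three_le hd hr]
    simp [green, heatConst, show d ≠ 1 by omega, show d ≠ 2 by omega]

/-- The factor of the value at the origin in the time integral of the Fourier transform of the
regularised heat kernel. -/
def heatSymbol (d : ℕ) (r : ℝ) : ℝ :=
  if d = 1 then 1 else if d = 2 then Real.exp (-r ^ 2) else 0

theorem integral_exp_neg_mul_sub {d : ℕ} {r : ℝ} (hr : 0 < r) (z w : ℂ) :
    ∫ t in Ioi 0, ((Real.exp (-(t * r ^ 2)) : ℝ) : ℂ) * (z - heatWeight d t * w) =
      (z - heatSymbol d r * w) / ((r ^ 2 : ℝ) : ℂ) := by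
  have hK : 0 < r ^ 2 := by positivity
  have hi : ∀ c, IntegrableOn (fun t : ℝ => ((Real.exp (-(t * r ^ 2)) : ℝ) : ℂ)) (Ioi c) := fun c => by
    have : IntegrableOn (fun t : ℝ => ((Real.exp (-r ^ 2 * t) : ℝ) : ℂ)) (Ioi c) :=
      (exp_neg_integrableOn_Ioi c hK).ofReal
    refine this.congr_fun (fun t _ => ?_) measurableSet_Ioi
    simp only [neg_mul, mul_comm t]
  have hv : ∀ c, ∫ t in Ioi c, ((Real.exp (-(t * r ^ 2)) : ℝ) : ℂ) =
      ((Real.exp (-(c * r ^ 2)) / r ^ 2 : ℝ) : ℂ) := fun c => by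
    rw [integral_complex_ofReal]
    congr 1
    have := integral_exp_mul_Ioi (a := -r ^ 2) (by linarith) c
    rw [← neg_div_neg_eq, ← show c * -r ^ 2 = -(c * r ^ 2) by ring, mul_comm c, ← this]
    congr 1 with t
    ring_nf
  have hw : ∀ t, ((Real.exp (-(t * r ^ 2)) : ℝ) : ℂ) * (heatWeight d t * w) =
      heatWeight d t * ((Real.exp (-(t * r ^ 2)) : ℝ) : ℂ) * w := fun t => by ring
  have h2 : IntegrableOn (fun t : ℝ => (heatWeight d t : ℂ) * ((Real.exp (-(t * r ^ 2)) : ℝ) : ℂ))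
        (Ioi 0) ∧
      ∫ t in Ioi 0, (heatWeight d t : ℂ) * ((Real.exp (-(t * r ^ 2)) : ℝ) : ℂ) =
        heatSymbol d r / ((r ^ 2 : ℝ) : ℂ) := by
    by_cases h1 : d = 1
    · simp only [heatWeight, heatSymbol, h1, if_true, Complex.ofReal_one, one_mul]
      refine ⟨hi 0, ?_⟩
      rw [hv 0]
      simp
    by_cases h2 : d = 2
    · have e : (fun t : ℝ => (heatWeight d t : ℂ) * ((Real.exp (-(t * r ^ 2)) : ℝ) : ℂ)) =
          (Ioi 1).indicator fun t : ℝ => ((Real.exp (-(t * r ^ 2)) : ℝ) : ℂ) := by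
        ext t
        by_cases ht : 1 < t <;> simp [heatWeight, h2, ht]
      rw [e]
      refine ⟨(hi 0).indicator measurableSet_Ioi, ?_⟩
      rw [setIntegral_indicator measurableSet_Ioi, Ioi_inter_Ioi, sup_eq_right.2 zero_le_one, hv 1]
      simp [heatSymbol, h2]
    · simp [heatWeight, heatSymbol, h1, h2]
  simp_rw [mul_sub, hw]
  rw [integral_sub ((hi 0).mul_const z) (h2.1.mul_const w), integral_mul_const, integral_mul_const,
    h2.2, hv 0]
  simp
  ring

/-- The common majorant in time, for every dimension, in both the position and the frequency
estimates. -/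
theorem integrableOn_heat_bound :
    IntegrableOn (fun t : ℝ => if t ≤ 1 then t ^ (-(1 / 2) : ℝ) else t ^ (-(3 / 2) : ℝ)) (Ioi 0) := by
  rw [← Ioc_union_Ioi_eq_Ioi (zero_le_one' ℝ), integrableOn_union]
  constructor
  · have h := intervalIntegral.intervalIntegrable_rpow' (a := 0) (b := 1) (r := (-(1 / 2) : ℝ))
      (by norm_num)
    rw [intervalIntegrable_iff_integrableOn_Ioc_of_le zero_le_one] at h
    exact h.congr_fun (fun t ht => by simp [ht.2]) measurableSet_Ioc
  · exact (integrableOn_Ioi_rpow_of_lt (a := (-(3 / 2) : ℝ)) (by norm_num) one_pos).congr_fun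
      (fun t (ht : 1 < t) => by simp [not_le.2 ht]) measurableSet_Ioi

end Heat

end CutoffGreen

end

noncomputable section

namespace CutoffGreen

/-! ### Gaussian integrals and space-time integrability in position space -/

section HeatFubini

open Set Filter Topology

theorem integrable_prod_of_le_heat_bound {X : Type*} [MeasurableSpace X] {μ : Measure X} [SFinite μ]
    {F : ℝ × X → ℂ} (hF : Measurable F) {C : ℝ}
    (h : ∀ t > 0, ∃ G : X → ℝ, Integrable G μ ∧ (∀ x, ‖F (t, x)‖ ≤ G x) ∧
      ∫ x, G x ∂μ ≤ C * if t ≤ 1 then t ^ (-(1 / 2) : ℝ) else t ^ (-(3 / 2) : ℝ)) :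
    Integrable F ((volume.restrict (Ioi 0)).prod μ) := by
  have hm : ∀ t, AEStronglyMeasurable (fun x => F (t, x)) μ := fun t =>
    (hF.comp measurable_prodMk_left).aestronglyMeasurable
  rw [integrable_prod_iff hF.aestronglyMeasurable]
  refine ⟨(ae_restrict_iff' measurableSet_Ioi).2 (Eventually.of_forall fun t ht => ?_), ?_⟩
  · obtain ⟨G, hG, hle, -⟩ := h t ht
    exact hG.mono' (hm t) (Eventually.of_forall hle)
  · refine (integrableOn_heat_bound.const_mul C).mono'
      (hF.norm.stronglyMeasurable.integral_prod_right).aestronglyMeasurable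
      ((ae_restrict_iff' measurableSet_Ioi).2 (Eventually.of_forall fun t ht => ?_))
    obtain ⟨G, hG, hle, hb⟩ := h t ht
    rw [Real.norm_of_nonneg (integral_nonneg fun x => norm_nonneg _)]
    exact (integral_mono (hG.mono' (hm t) (Eventually.of_forall hle)).norm hG hle).trans hb

theorem integral_exp_neg_mul_sq (d : ℕ) {b : ℝ} (hb : 0 < b) :
    ∫ x : Space d, Real.exp (-b * ‖x‖ ^ 2) = (Real.pi / b) ^ ((d : ℝ) / 2) := by
  rw [GaussianFourier.integral_rexp_neg_mul_sq_norm hb, finrank_euclideanSpace_fin]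

theorem integrable_exp_neg_mul_sq (d : ℕ) {b : ℝ} (hb : 0 < b) :
    Integrable fun x : Space d => Real.exp (-b * ‖x‖ ^ 2) := by
  refine Integrable.of_integral_ne_zero ?_
  rw [integral_exp_neg_mul_sq d hb]
  have := Real.pi_pos
  positivity

theorem heat_eq (d : ℕ) {t : ℝ} (r : ℝ) :
    heat d t r = (4 * Real.pi * t) ^ (-((d : ℝ) / 2)) * Real.exp (-(1 / (4 * t)) * r ^ 2) := by
  rw [heat]; congr 2; ring

theorem integrable_heat (d : ℕ) {t : ℝ} (ht : 0 < t) : Integrable fun x : Space d => heat d t ‖x‖ := by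
  simp_rw [heat_eq]
  exact (integrable_exp_neg_mul_sq d (by positivity)).const_mul _

theorem integral_heat_space (d : ℕ) {t : ℝ} (ht : 0 < t) : ∫ x : Space d, heat d t ‖x‖ = 1 := by
  have hpi := Real.pi_pos
  simp_rw [heat_eq]
  rw [integral_const_mul, integral_exp_neg_mul_sq d (by positivity),
    show Real.pi / (1 / (4 * t)) = 4 * Real.pi * t by field_simp, ← Real.rpow_add (by positivity)]
  simp

theorem integral_heat_mul_planeWave (d : ℕ) {t : ℝ} (ht : 0 < t) (k : Space d) :
    ∫ x : Space d, ((heat d t ‖x‖ : ℝ) : ℂ) * planeWave k x =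
      ((Real.exp (-(t * ‖k‖ ^ 2)) : ℝ) : ℂ) := by
  have hpi := Real.pi_pos
  have hb : 0 < ((1 / (4 * t) : ℝ) : ℂ).re := by rw [Complex.ofReal_re]; positivity
  have h := GaussianFourier.integral_cexp_neg_mul_sq_norm_add hb Complex.I k
  have e : ∀ x : Space d, ((heat d t ‖x‖ : ℝ) : ℂ) * planeWave k x =
      (((4 * Real.pi * t) ^ (-((d : ℝ) / 2)) : ℝ) : ℂ) *
        Complex.exp (-((1 / (4 * t) : ℝ) : ℂ) * ‖x‖ ^ 2 + Complex.I * (inner ℝ k x : ℝ)) := by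
    intro x
    rw [heat_eq, planeWave, Complex.exp_add]
    push_cast
    ring
  simp_rw [e]
  rw [integral_const_mul, h, finrank_euclideanSpace_fin]
  have e1 : (Real.pi : ℂ) / ((1 / (4 * t) : ℝ) : ℂ) = ((4 * Real.pi * t : ℝ) : ℂ) := by
    have : (t : ℂ) ≠ 0 := by exact_mod_cast ht.ne'
    push_cast; field_simp
  have e2 : ((4 * Real.pi * t : ℝ) : ℂ) ^ ((d : ℂ) / 2) =
      (((4 * Real.pi * t) ^ ((d : ℝ) / 2) : ℝ) : ℂ) := by
    rw [Complex.ofReal_cpow (by positivity)]; push_cast; rfl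
  have e3 : Complex.I ^ 2 * (‖k‖ : ℂ) ^ 2 / (4 * ((1 / (4 * t) : ℝ) : ℂ)) =
      ((-(t * ‖k‖ ^ 2) : ℝ) : ℂ) := by
    have : (t : ℂ) ≠ 0 := by exact_mod_cast ht.ne'
    rw [Complex.I_sq]
    push_cast; field_simp
  rw [e1, e2, e3, ← mul_assoc, ← Complex.ofReal_mul, ← Real.rpow_add (by positivity)]
  simp

/-- Fourier inversion for the Gaussian at the origin. It matches the subtraction at x = 0 of the
kernel with the subtraction of φ(0) in frequency. -/
theorem heat_zero_mul (d : ℕ) {t : ℝ} (ht : 0 < t) :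
    heat d t 0 * (2 * Real.pi) ^ d = ∫ k : Space d, Real.exp (-(t * ‖k‖ ^ 2)) := by
  have hpi := Real.pi_pos
  simp_rw [← neg_mul]
  rw [integral_exp_neg_mul_sq d ht, heat_zero, ← Real.rpow_natCast (2 * Real.pi),
    Real.rpow_neg (by positivity), show ((d : ℝ)) = 2 * ((d : ℝ) / 2) by ring,
    Real.rpow_mul (by positivity), ← Real.inv_rpow (by positivity),
    show 2 * ((d : ℝ) / 2) / 2 = (d : ℝ) / 2 by ring, ← Real.mul_rpow (by positivity) (by positivity)]
  congr 1
  rw [Real.rpow_two]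
  field_simp
  ring

theorem measurable_heatWeight (d : ℕ) : Measurable (heatWeight d) := by
  unfold heatWeight
  split_ifs
  · exact measurable_const
  · exact Measurable.ite measurableSet_Ioi measurable_const measurable_const
  · exact measurable_const

theorem heatWeight_nonneg (d : ℕ) (t : ℝ) : 0 ≤ heatWeight d t := by
  unfold heatWeight; split_ifs <;> norm_num

theorem measurable_heat (d : ℕ) : Measurable fun p : ℝ × ℝ => heat d p.1 p.2 := by
  unfold heat; fun_prop

theorem rpow_neg_le_of_le_one {t p : ℝ} (ht : 0 < t) (ht1 : t ≤ 1) (hp : 0 ≤ p) : 1 ≤ t ^ (-p) := by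
  rw [Real.rpow_neg ht.le]
  exact (one_le_inv₀ (by positivity)).2 (Real.rpow_le_one ht.le ht1 hp)

theorem heat_zero_le (d : ℕ) {t : ℝ} (ht : 0 < t) : heat d t 0 ≤ t ^ (-((d : ℝ) / 2)) := by
  have hpi := Real.two_le_pi
  rw [heat_zero]
  exact Real.rpow_le_rpow_of_nonpos ht (by nlinarith) (by simp; positivity)

theorem heat_le_heat_zero (d : ℕ) {t : ℝ} (ht : 0 < t) (r : ℝ) : heat d t r ≤ heat d t 0 := by
  have hpi := Real.pi_pos
  rw [heat_zero, heat]
  refine mul_le_of_le_one_right (by positivity) (Real.exp_le_one_iff.2 ?_)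
  simp; positivity

theorem abs_heat_sub_le (d : ℕ) {t : ℝ} (ht : 0 < t) (r : ℝ) :
    |heat d t r - heat d t 0| ≤ heat d t 0 * (r ^ 2 / t) := by
  have hpi := Real.pi_pos
  have h0 : 0 ≤ heat d t 0 := heat_nonneg ht
  have : heat d t r - heat d t 0 = heat d t 0 * (Real.exp (-(r ^ 2 / (4 * t))) - 1) := by
    rw [heat_zero, heat]; ring
  rw [this, abs_mul, abs_of_nonneg h0]
  gcongr
  refine (abs_exp_neg_sub_one_le (by positivity)).trans ?_
  gcongr
  linarith

theorem abs_heat_sub_heatWeight_le_of_le_one {d : ℕ} {t : ℝ} (ht : 0 < t) (ht1 : t ≤ 1) (r : ℝ) :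
    |heat d t r - heatWeight d t * heat d t 0| ≤ heat d t r + t ^ (-(1 / 2) : ℝ) := by
  have h0 : 0 ≤ heat d t 0 := heat_nonneg ht
  have hr : 0 ≤ heat d t r := heat_nonneg ht
  have hw : heatWeight d t * heat d t 0 ≤ t ^ (-(1 / 2) : ℝ) := by
    by_cases h1 : d = 1
    · subst h1
      simpa [heatWeight] using heat_zero_le 1 ht
    · have : heatWeight d t = 0 := by simp [heatWeight, h1, not_lt.2 ht1]
      rw [this, zero_mul]; positivity
  have hw0 : 0 ≤ heatWeight d t * heat d t 0 := mul_nonneg (heatWeight_nonneg d t) h0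
  rw [abs_le]; constructor <;> linarith

/-- For d ≥ 3 the decay t^{-d/2} is enough; for d = 1, 2 the subtraction gains a factor r²/t. -/
theorem abs_heat_sub_heatWeight_le_of_one_lt {d : ℕ} (hd : 1 ≤ d) {t : ℝ} (ht1 : 1 < t) (r : ℝ) :
    |heat d t r - heatWeight d t * heat d t 0| ≤ t ^ (-(3 / 2) : ℝ) * (1 + r ^ 2) := by
  have ht : 0 < t := by linarith
  have h0 : 0 ≤ heat d t 0 := heat_nonneg ht
  have hz := heat_zero_le d ht
  have hp : 0 < t ^ (-(3 / 2) : ℝ) := by positivity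
  rcases le_or_gt 3 d with h3 | h3
  · have hd' : (3 : ℝ) ≤ d := by exact_mod_cast h3
    have : heatWeight d t = 0 := by
      simp [heatWeight, show d ≠ 1 by omega, show d ≠ 2 by omega]
    rw [this, zero_mul, sub_zero, abs_of_nonneg (heat_nonneg ht)]
    have h1 : t ^ (-((d : ℝ) / 2)) ≤ t ^ (-(3 / 2) : ℝ) :=
      Real.rpow_le_rpow_of_exponent_le ht1.le (by linarith)
    have h2 := heat_le_heat_zero d ht r
    nlinarith [sq_nonneg r]
  · have hd' : (1 : ℝ) ≤ d := by exact_mod_cast hd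
    have : heatWeight d t = 1 := by
      obtain rfl | rfl : d = 1 ∨ d = 2 := by omega
      · simp [heatWeight]
      · simp [heatWeight, ht1]
    rw [this, one_mul]
    have h1 : t ^ (-((d : ℝ) / 2)) ≤ t ^ (-(1 / 2) : ℝ) :=
      Real.rpow_le_rpow_of_exponent_le ht1.le (by linarith)
    have e : t ^ (-(3 / 2) : ℝ) = t ^ (-(1 / 2) : ℝ) / t := by
      rw [← Real.rpow_sub_one ht.ne']; norm_num
    calc |heat d t r - heat d t 0| ≤ heat d t 0 * (r ^ 2 / t) := abs_heat_sub_le d ht r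
      _ ≤ t ^ (-(1 / 2) : ℝ) * (r ^ 2 / t) := by gcongr; exact hz.trans h1
      _ = t ^ (-(3 / 2) : ℝ) * r ^ 2 := by rw [e]; ring
      _ ≤ _ := by gcongr; linarith

/-- The regularised heat kernel, paired with a Schwartz function, is integrable in space-time. -/
theorem integrable_heat_sub_mul {d : ℕ} (hd : 1 ≤ d) (g : 𝓢(Space d, ℂ)) :
    Integrable (fun p : ℝ × Space d =>
      ((heat d p.1 ‖p.2‖ - heatWeight d p.1 * heat d p.1 0 : ℝ) : ℂ) * g p.2)
      ((volume.restrict (Ioi 0)).prod volume) := by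
  have hg1 : Integrable fun x => ‖g x‖ := g.integrable.norm
  have hg2 : Integrable fun x => ‖x‖ ^ 2 * ‖g x‖ := g.integrable_pow_mul volume 2
  obtain ⟨M, hM0, hM⟩ := g.decay 0 0
  simp only [pow_zero, one_mul, norm_iteratedFDeriv_zero] at hM
  have hI1 : 0 ≤ ∫ x, ‖g x‖ := integral_nonneg fun x => norm_nonneg _
  have hI2 : 0 ≤ ∫ x, ‖x‖ ^ 2 * ‖g x‖ := integral_nonneg fun x => by positivity
  refine integrable_prod_of_le_heat_bound (C := M + (∫ x, ‖g x‖) + ∫ x, ‖x‖ ^ 2 * ‖g x‖)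
    ?_ fun t ht => ?_
  · have h1 : Measurable fun p : ℝ × Space d => heat d p.1 ‖p.2‖ :=
      (measurable_heat d).comp (measurable_fst.prodMk measurable_snd.norm)
    have h2 : Measurable fun p : ℝ × Space d => heat d p.1 0 :=
      (measurable_heat d).comp (measurable_fst.prodMk measurable_const)
    have h3 : Measurable fun p : ℝ × Space d => heatWeight d p.1 :=
      (measurable_heatWeight d).comp measurable_fst
    exact (Complex.measurable_ofReal.comp (h1.sub (h3.mul h2))).mul
      (g.continuous.measurable.comp measurable_snd)
  split_ifs with ht1
  · have hone := rpow_neg_le_of_le_one ht ht1 (p := 1 / 2) (by norm_num)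
    refine ⟨fun x => M * heat d t ‖x‖ + t ^ (-(1 / 2) : ℝ) * ‖g x‖,
      ((integrable_heat d ht).const_mul M).add (hg1.const_mul _), fun x => ?_, ?_⟩
    · rw [norm_mul, Complex.norm_real, Real.norm_eq_abs]
      have h1 := abs_heat_sub_heatWeight_le_of_le_one (d := d) ht ht1 ‖x‖
      have h2 := hM x
      have h3 : 0 ≤ heat d t ‖x‖ := heat_nonneg ht
      calc _ ≤ (heat d t ‖x‖ + t ^ (-(1 / 2) : ℝ)) * ‖g x‖ := by gcongr
        _ = heat d t ‖x‖ * ‖g x‖ + t ^ (-(1 / 2) : ℝ) * ‖g x‖ := by ring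
        _ ≤ heat d t ‖x‖ * M + t ^ (-(1 / 2) : ℝ) * ‖g x‖ := by gcongr
        _ = _ := by ring
    · rw [integral_add ((integrable_heat d ht).const_mul M) (hg1.const_mul _), integral_const_mul,
        integral_const_mul, integral_heat_space d ht]
      nlinarith [mul_nonneg hI2 (by linarith : (0 : ℝ) ≤ t ^ (-(1 / 2) : ℝ)),
        mul_nonneg hM0.le (by linarith : (0 : ℝ) ≤ t ^ (-(1 / 2) : ℝ) - 1)]
  · rw [not_le] at ht1
    have hp : 0 < t ^ (-(3 / 2) : ℝ) := by positivity
    refine ⟨fun x => t ^ (-(3 / 2) : ℝ) * (‖g x‖ + ‖x‖ ^ 2 * ‖g x‖),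
      (hg1.add hg2).const_mul _, fun x => ?_, ?_⟩
    · rw [norm_mul, Complex.norm_real, Real.norm_eq_abs]
      calc _ ≤ t ^ (-(3 / 2) : ℝ) * (1 + ‖x‖ ^ 2) * ‖g x‖ := by
            gcongr; exact abs_heat_sub_heatWeight_le_of_one_lt hd ht1 ‖x‖
        _ = _ := by ring
    · rw [integral_const_mul, integral_add hg1 hg2]
      nlinarith [mul_nonneg hM0.le hp.le]

/-- `φ`, symmetrised under `k ↦ -k` in dimension one. -/
def symmPart (d : ℕ) (φ : Space d → ℂ) (k : Space d) : ℂ :=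
  if d = 1 then (φ k + φ (-k)) / 2 else φ k

end HeatFubini

end CutoffGreen

end

noncomputable section

namespace CutoffGreen

/-! ### The same integral in frequency space -/

section HeatFourier

open Set Filter Topology

theorem exists_norm_sub_le {E F : Type*} [NormedAddCommGroup E] [NormedSpace ℝ E]
    [NormedAddCommGroup F] [NormedSpace ℝ F] (φ : 𝓢(E, F)) :
    ∃ L, 0 ≤ L ∧ ∀ x y, ‖φ x - φ y‖ ≤ L * ‖x - y‖ := by
  obtain ⟨L, hL0, hL⟩ := φ.decay 0 1
  refine ⟨L, hL0.le, fun x y => ?_⟩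
  refine Convex.norm_image_sub_le_of_norm_fderiv_le (𝕜 := ℝ) (s := univ)
    (fun z _ => φ.differentiableAt) (fun z _ => ?_) convex_univ (mem_univ y) (mem_univ x)
  have := hL z
  rwa [pow_zero, one_mul, norm_iteratedFDeriv_one] at this

/-- The derivative of φ(x) + φ(-x) is Dφ(x) - Dφ(-x), which is O(‖x‖) because Dφ is Lipschitz; the
mean value inequality on the ball of radius ‖k‖ gives the second power. -/
theorem exists_norm_add_neg_sub_le {E : Type*} [NormedAddCommGroup E] [NormedSpace ℝ E]
    (φ : 𝓢(E, ℂ)) : ∃ L, 0 ≤ L ∧ ∀ k, ‖(φ k + φ (-k)) / 2 - φ 0‖ ≤ L * ‖k‖ ^ 2 := by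
  obtain ⟨L, hL0, hL⟩ := exists_norm_sub_le (SchwartzMap.fderivCLM ℝ E ℂ φ)
  simp only [SchwartzMap.fderivCLM_apply] at hL
  refine ⟨L, hL0, fun k => ?_⟩
  have hd : ∀ x : E, HasFDerivAt (fun x => φ x + φ (-x)) (fderiv ℝ φ x - fderiv ℝ φ (-x)) x := by
    intro x
    have h1 := (φ.differentiableAt (x := x)).hasFDerivAt
    have h2 := (φ.differentiableAt (x := -x)).hasFDerivAt.comp x (hasFDerivAt_id x).neg
    refine (h1.add h2).congr_fderiv ?_
    ext v
    simp [sub_eq_add_neg]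
  have h := Convex.norm_image_sub_le_of_norm_hasFDerivWithin_le (𝕜 := ℝ)
    (f := fun x => φ x + φ (-x)) (s := Metric.closedBall (0 : E) ‖k‖) (C := L * (2 * ‖k‖))
    (x := 0) (y := k) (fun x _ => (hd x).hasFDerivWithinAt) (fun x hx => ?_)
    (convex_closedBall _ _) (by simp) (by simp)
  · have e : (φ k + φ (-k)) / 2 - φ 0 = (φ k + φ (-k) - (φ 0 + φ (-0))) / 2 := by
      rw [neg_zero]; ring
    rw [e, norm_div, Complex.norm_two]
    rw [sub_zero] at h
    linarith
  · refine (hL x (-x)).trans ?_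
    rw [sub_neg_eq_add, ← two_smul ℝ x, norm_smul, Real.norm_two]
    gcongr
    simpa using hx

theorem continuous_symmPart (d : ℕ) {φ : Space d → ℂ} (hφ : Continuous φ) :
    Continuous (symmPart d φ) := by
  unfold symmPart
  split_ifs
  · fun_prop
  · exact hφ

theorem integrable_symmPart (d : ℕ) {φ : Space d → ℂ} (hφ : Integrable φ) :
    Integrable (symmPart d φ) := by
  unfold symmPart
  split_ifs
  · exact (hφ.add hφ.comp_neg).div_const 2
  · exact hφ

theorem integral_mul_symmPart (d : ℕ) {φ w : Space d → ℂ} (hw : ∀ k, w (-k) = w k)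
    (hφ : Integrable fun k => w k * φ k) :
    ∫ k, w k * symmPart d φ k = ∫ k, w k * φ k := by
  unfold symmPart
  split_ifs
  · have h : ∀ k, w k * ((φ k + φ (-k)) / 2) = (w k * φ k + w (-k) * φ (-k)) / 2 := fun k => by
      rw [hw]; ring
    simp_rw [h]
    rw [integral_div, integral_add hφ hφ.comp_neg,
      integral_neg_eq_self (fun k => w k * φ k) volume]
    ring
  · rfl

theorem pow_mul_exp_neg_le {j : ℕ} (hj : j ≤ 2) (u : ℝ) :
    u ^ j * Real.exp (-(u ^ 2 / 2)) ≤ 2 := by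
  rw [Real.exp_neg, ← div_eq_mul_inv, div_le_iff₀ (Real.exp_pos _)]
  have h := Real.add_one_le_exp (u ^ 2 / 2)
  interval_cases j <;> nlinarith [sq_nonneg (u - 1)]

/-- Vanishing to order j at the origin makes the Gaussian integral O(t^{-(j+d)/2}), so j + d ≥ 3
yields the integrable rate t^{-3/2}. For d = 1 this needs j = 2, which is why φ is symmetrised. -/
theorem exists_norm_symmPart_sub_le {d : ℕ} (hd : 1 ≤ d) (φ : 𝓢(Space d, ℂ)) :
    ∃ j : ℕ, j ≤ 2 ∧ 3 ≤ j + d ∧ ∃ L, 0 ≤ L ∧ ∀ t, 1 < t → ∀ k,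
      ‖symmPart d φ k - heatWeight d t * φ 0‖ ≤ L * ‖k‖ ^ j := by
  obtain rfl | rfl | hd : d = 1 ∨ d = 2 ∨ 3 ≤ d := by omega
  · obtain ⟨L, hL0, hL⟩ := exists_norm_add_neg_sub_le φ
    exact ⟨2, le_rfl, le_rfl, L, hL0, fun t _ k => by simpa [symmPart, heatWeight] using hL k⟩
  · obtain ⟨L, hL0, hL⟩ := exists_norm_sub_le φ
    exact ⟨1, by norm_num, le_rfl, L, hL0, fun t ht k => by
      simpa [symmPart, heatWeight, ht] using hL k 0⟩
  · obtain ⟨M, hM0, hM⟩ := φ.decay 0 0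
    refine ⟨0, by norm_num, by omega, M, hM0.le, fun t _ k => ?_⟩
    simpa [symmPart, heatWeight, show d ≠ 1 by omega, show d ≠ 2 by omega] using hM k

/-- Half of the Gaussian absorbs the power of √t r; the other half remains to be integrated. -/
theorem exp_neg_mul_pow_le {j : ℕ} (hj : j ≤ 2) {t : ℝ} (ht : 0 < t) (r : ℝ) :
    Real.exp (-(t * r ^ 2)) * r ^ j ≤
      2 * t ^ (-((j : ℝ) / 2)) * Real.exp (-(t / 2) * r ^ 2) := by
  have h := pow_mul_exp_neg_le hj (√t * r)
  have e1 : (√t * r) ^ 2 = t * r ^ 2 := by rw [mul_pow, Real.sq_sqrt ht.le]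
  have e2 : √t ^ j = t ^ ((j : ℝ) / 2) := by
    rw [Real.sqrt_eq_rpow, ← Real.rpow_natCast, ← Real.rpow_mul ht.le]; congr 1; ring
  have e3 : Real.exp (-(t * r ^ 2)) =
      Real.exp (-(t * r ^ 2 / 2)) * Real.exp (-(t / 2) * r ^ 2) := by
    rw [← Real.exp_add]; congr 1; ring
  rw [e1, mul_pow, e2] at h
  rw [e3, Real.rpow_neg ht.le]
  have hp : 0 < t ^ ((j : ℝ) / 2) := by positivity
  have : r ^ j * Real.exp (-(t * r ^ 2 / 2)) ≤ 2 * (t ^ ((j : ℝ) / 2))⁻¹ := by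
    rw [← div_eq_mul_inv, le_div_iff₀ hp]; linarith
  calc _ = r ^ j * Real.exp (-(t * r ^ 2 / 2)) * Real.exp (-(t / 2) * r ^ 2) := by ring
    _ ≤ _ := by gcongr

/-- The Fourier transform of the regularised heat kernel, paired with a Schwartz function, is
integrable in space-time. -/
theorem integrable_exp_mul_symmPart_sub {d : ℕ} (hd : 1 ≤ d) (φ : 𝓢(Space d, ℂ)) :
    Integrable (fun p : ℝ × Space d => ((Real.exp (-(p.1 * ‖p.2‖ ^ 2)) : ℝ) : ℂ) *
      (symmPart d φ p.2 - heatWeight d p.1 * φ 0))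
      ((volume.restrict (Ioi 0)).prod volume) := by
  have hpi := Real.pi_pos
  have hψ := (integrable_symmPart d (φ.integrable (μ := volume))).norm
  obtain ⟨j, hj2, hjd, L, hL0, hL⟩ := exists_norm_symmPart_sub_le hd φ
  have hI : 0 ≤ ∫ k, ‖symmPart d φ k‖ := integral_nonneg fun k => norm_nonneg _
  set C₁ := √Real.pi * ‖φ 0‖
  set C₂ := L * (2 * (2 * Real.pi) ^ ((d : ℝ) / 2))
  have hC₁ : 0 ≤ C₁ := by positivity
  have hC₂ : 0 ≤ C₂ := by positivity
  refine integrable_prod_of_le_heat_bound (C := (∫ k, ‖symmPart d φ k‖) + C₁ + C₂) ?_ fun t ht => ?_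
  · have h1 : Measurable fun p : ℝ × Space d => Real.exp (-(p.1 * ‖p.2‖ ^ 2)) := by fun_prop
    have h2 : Measurable fun p : ℝ × Space d => symmPart d φ p.2 :=
      (continuous_symmPart d φ.continuous).measurable.comp measurable_snd
    have h3 : Measurable fun p : ℝ × Space d => heatWeight d p.1 :=
      (measurable_heatWeight d).comp measurable_fst
    exact (Complex.measurable_ofReal.comp h1).mul
      (h2.sub ((Complex.measurable_ofReal.comp h3).mul_const _))
  have hnorm : ∀ k : Space d, ‖((Real.exp (-(t * ‖k‖ ^ 2)) : ℝ) : ℂ) *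
      (symmPart d φ k - heatWeight d t * φ 0)‖ =
      Real.exp (-(t * ‖k‖ ^ 2)) * ‖symmPart d φ k - heatWeight d t * φ 0‖ := fun k => by
    rw [norm_mul, Complex.norm_real, Real.norm_of_nonneg (Real.exp_pos _).le]
  simp only [hnorm]
  split_ifs with ht1
  · have hone := rpow_neg_le_of_le_one ht ht1 (p := 1 / 2) (by norm_num)
    have hg := integrable_exp_neg_mul_sq d ht
    refine ⟨fun k => ‖symmPart d φ k‖ + heatWeight d t * ‖φ 0‖ * Real.exp (-t * ‖k‖ ^ 2),
      hψ.add (hg.const_mul _), fun k => ?_, ?_⟩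
    · have he : Real.exp (-(t * ‖k‖ ^ 2)) ≤ 1 := Real.exp_le_one_iff.2 (by
        have : 0 ≤ t * ‖k‖ ^ 2 := by positivity
        linarith)
      have h1 := norm_sub_le (symmPart d φ k) (heatWeight d t * φ 0)
      rw [norm_mul, Complex.norm_real, Real.norm_of_nonneg (heatWeight_nonneg d t)] at h1
      have hw := heatWeight_nonneg d t
      simp only [neg_mul]
      calc _ ≤ Real.exp (-(t * ‖k‖ ^ 2)) * (‖symmPart d φ k‖ + heatWeight d t * ‖φ 0‖) := by gcongr
        _ = Real.exp (-(t * ‖k‖ ^ 2)) * ‖symmPart d φ k‖ +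
          heatWeight d t * ‖φ 0‖ * Real.exp (-(t * ‖k‖ ^ 2)) := by ring
        _ ≤ _ := by gcongr; exact mul_le_of_le_one_left (norm_nonneg _) he
    · rw [integral_add hψ (hg.const_mul _), integral_const_mul, integral_exp_neg_mul_sq d ht]
      have : heatWeight d t * ‖φ 0‖ * (Real.pi / t) ^ ((d : ℝ) / 2) ≤ C₁ * t ^ (-(1 / 2) : ℝ) := by
        by_cases h1 : d = 1
        · have : (Real.pi / t) ^ ((d : ℝ) / 2) = √Real.pi * t ^ (-(1 / 2) : ℝ) := by
            rw [h1, Nat.cast_one, Real.div_rpow hpi.le ht.le, Real.rpow_neg ht.le,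
              Real.sqrt_eq_rpow]
            rfl
          rw [this]
          simp only [heatWeight, h1, if_true, C₁]
          exact le_of_eq (by ring)
        · have : heatWeight d t = 0 := by simp [heatWeight, h1, not_lt.2 ht1]
          rw [this]; simp only [zero_mul]; positivity
      nlinarith [mul_nonneg hC₂ (by linarith : (0 : ℝ) ≤ t ^ (-(1 / 2) : ℝ)),
        mul_nonneg hI (by linarith : (0 : ℝ) ≤ t ^ (-(1 / 2) : ℝ) - 1)]
  · rw [not_le] at ht1
    have hp : 0 < t ^ (-(3 / 2) : ℝ) := by positivity
    have hg := integrable_exp_neg_mul_sq d (half_pos ht)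
    refine ⟨fun k => L * (2 * t ^ (-((j : ℝ) / 2))) * Real.exp (-(t / 2) * ‖k‖ ^ 2),
      hg.const_mul _, fun k => ?_, ?_⟩
    · calc _ ≤ Real.exp (-(t * ‖k‖ ^ 2)) * (L * ‖k‖ ^ j) := by gcongr; exact hL t ht1 k
        _ = L * (Real.exp (-(t * ‖k‖ ^ 2)) * ‖k‖ ^ j) := by ring
        _ ≤ L * (2 * t ^ (-((j : ℝ) / 2)) * Real.exp (-(t / 2) * ‖k‖ ^ 2)) := by
          exact mul_le_mul_of_nonneg_left (exp_neg_mul_pow_le hj2 ht ‖k‖) hL0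
        _ = _ := by ring
    · rw [integral_const_mul, integral_exp_neg_mul_sq d (half_pos ht)]
      have e1 : (Real.pi / (t / 2)) ^ ((d : ℝ) / 2) =
          (2 * Real.pi) ^ ((d : ℝ) / 2) * t ^ (-((d : ℝ) / 2)) := by
        rw [show Real.pi / (t / 2) = 2 * Real.pi / t by field_simp, Real.div_rpow (by positivity)
          ht.le, Real.rpow_neg ht.le]
        rfl
      have e2 : t ^ (-((j : ℝ) / 2)) * t ^ (-((d : ℝ) / 2)) ≤ t ^ (-(3 / 2) : ℝ) := by
        rw [← Real.rpow_add ht]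
        refine Real.rpow_le_rpow_of_exponent_le ht1.le ?_
        have : (3 : ℝ) ≤ j + d := by exact_mod_cast hjd
        linarith
      rw [e1]
      calc _ = C₂ * (t ^ (-((j : ℝ) / 2)) * t ^ (-((d : ℝ) / 2))) := by simp only [C₂]; ring
        _ ≤ C₂ * t ^ (-(3 / 2) : ℝ) := by gcongr
        _ ≤ _ := by gcongr; linarith

/-- The multiplication formula handles the Gaussian, and `integral_waveFourier` with `heat_zero_mul`
handles the constant. Evenness of e^{-t‖k‖²} allows φ to be symmetrised. -/
theorem integral_heat_mul_waveFourier (d : ℕ) (φ : 𝓢(Space d, ℂ)) {t : ℝ} (ht : 0 < t) :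
    ∫ x : Space d, ((heat d t ‖x‖ - heatWeight d t * heat d t 0 : ℝ) : ℂ) * waveFourier d φ x =
      ∫ k : Space d, ((Real.exp (-(t * ‖k‖ ^ 2)) : ℝ) : ℂ) *
        (symmPart d φ k - heatWeight d t * φ 0) := by
  have hφ := φ.integrable (μ := volume)
  have hφ' := (waveFourier d φ).integrable (μ := volume)
  have hh : Integrable fun x : Space d => ((heat d t ‖x‖ : ℝ) : ℂ) := (integrable_heat d ht).ofReal
  obtain ⟨M, hM0, hM⟩ := (waveFourier d φ).decay 0 0
  simp only [pow_zero, one_mul, norm_iteratedFDeriv_zero] at hM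
  have hhφ : Integrable fun x : Space d => ((heat d t ‖x‖ : ℝ) : ℂ) * waveFourier d φ x :=
    hh.mul_bdd (c := M) (waveFourier d φ).continuous.aestronglyMeasurable (Eventually.of_forall hM)
  have hg : Integrable fun k : Space d => ((Real.exp (-(t * ‖k‖ ^ 2)) : ℝ) : ℂ) := by
    have : Integrable fun k : Space d => ((Real.exp (-t * ‖k‖ ^ 2) : ℝ) : ℂ) :=
      (integrable_exp_neg_mul_sq d ht).ofReal
    simpa only [neg_mul] using this
  have hbd : ∀ k : Space d, ‖((Real.exp (-(t * ‖k‖ ^ 2)) : ℝ) : ℂ)‖ ≤ 1 := fun k => by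
    rw [Complex.norm_real, Real.norm_of_nonneg (Real.exp_pos _).le]
    refine Real.exp_le_one_iff.2 ?_
    have : 0 ≤ t * ‖k‖ ^ 2 := by positivity
    linarith
  have hgφ : Integrable fun k : Space d => ((Real.exp (-(t * ‖k‖ ^ 2)) : ℝ) : ℂ) * φ k :=
    hφ.bdd_mul (c := 1) hg.aestronglyMeasurable (Eventually.of_forall hbd)
  have hgψ : Integrable fun k : Space d =>
      ((Real.exp (-(t * ‖k‖ ^ 2)) : ℝ) : ℂ) * symmPart d φ k :=
    (integrable_symmPart d hφ).bdd_mul (c := 1) hg.aestronglyMeasurable (Eventually.of_forall hbd)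
  have h1 : ∫ x : Space d, ((heat d t ‖x‖ : ℝ) : ℂ) * waveFourier d φ x =
      ∫ k : Space d, ((Real.exp (-(t * ‖k‖ ^ 2)) : ℝ) : ℂ) * symmPart d φ k := by
    simp_rw [waveFourier_eq]
    rw [integral_mul_integral_planeWave hh hφ, integral_mul_symmPart d (by simp) hgφ]
    simp_rw [integral_heat_mul_planeWave d ht]
  have h2 : ((heat d t 0 : ℝ) : ℂ) * ∫ x : Space d, waveFourier d φ x =
      (∫ k : Space d, ((Real.exp (-(t * ‖k‖ ^ 2)) : ℝ) : ℂ)) * φ 0 := by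
    rw [integral_waveFourier, ← mul_assoc, ← Complex.ofReal_mul, heat_zero_mul d ht,
      integral_complex_ofReal]
  simp_rw [Complex.ofReal_sub, sub_mul, mul_sub, Complex.ofReal_mul, mul_assoc]
  rw [integral_sub hhφ ((hφ'.const_mul _).const_mul _),
    integral_sub hgψ (hg.mul_const (heatWeight d t * φ 0)), h1, integral_const_mul,
    integral_const_mul, h2, integral_mul_const]
  ring

theorem ae_ne_zero {d : ℕ} (hd : 1 ≤ d) : ∀ᵐ x : Space d, x ≠ 0 := by
  have : Nonempty (Fin d) := ⟨⟨0, hd⟩⟩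
  exact compl_mem_ae_iff.2 (measure_singleton 0)

theorem integrable_green_mul {d : ℕ} (hd : 1 ≤ d) (g : 𝓢(Space d, ℂ)) :
    Integrable fun x : Space d => ((green d ‖x‖ + heatConst d : ℝ) : ℂ) * g x := by
  refine (integrable_heat_sub_mul hd g).integral_prod_right.congr ?_
  filter_upwards [ae_ne_zero hd] with x hx
  rw [integral_mul_const, integral_complex_ofReal, integral_heat hd (norm_pos_iff.2 hx)]

theorem integrable_symmPart_sub_heatSymbol {d : ℕ} (hd : 1 ≤ d) (φ : 𝓢(Space d, ℂ)) :
    Integrable fun k : Space d =>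
      (symmPart d φ k - heatSymbol d ‖k‖ * φ 0) / ((‖k‖ ^ 2 : ℝ) : ℂ) := by
  refine (integrable_exp_mul_symmPart_sub hd φ).integral_prod_right.congr ?_
  filter_upwards [ae_ne_zero hd] with k hk
  exact integral_exp_neg_mul_sub (norm_pos_iff.2 hk) _ _

/-- The Fourier transform of `green`, up to the normalisation of the finite part. -/
theorem integral_green_mul_waveFourier {d : ℕ} (hd : 1 ≤ d) (φ : 𝓢(Space d, ℂ)) :
    ∫ x : Space d, ((green d ‖x‖ + heatConst d : ℝ) : ℂ) * waveFourier d φ x =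
      ∫ k : Space d, (symmPart d φ k - heatSymbol d ‖k‖ * φ 0) / ((‖k‖ ^ 2 : ℝ) : ℂ) := by
  calc _ = ∫ x : Space d, ∫ t in Ioi (0 : ℝ),
        ((heat d t ‖x‖ - heatWeight d t * heat d t 0 : ℝ) : ℂ) * waveFourier d φ x := by
        refine integral_congr_ae ?_
        filter_upwards [ae_ne_zero hd] with x hx
        rw [integral_mul_const, integral_complex_ofReal, integral_heat hd (norm_pos_iff.2 hx)]
    _ = ∫ t in Ioi (0 : ℝ), ∫ x : Space d,
        ((heat d t ‖x‖ - heatWeight d t * heat d t 0 : ℝ) : ℂ) * waveFourier d φ x :=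
        integral_integral_swap (integrable_heat_sub_mul hd (waveFourier d φ)).swap
    _ = ∫ t in Ioi (0 : ℝ), ∫ k : Space d, ((Real.exp (-(t * ‖k‖ ^ 2)) : ℝ) : ℂ) *
        (symmPart d φ k - heatWeight d t * φ 0) :=
        setIntegral_congr_fun measurableSet_Ioi fun t ht => integral_heat_mul_waveFourier d φ ht
    _ = ∫ k : Space d, ∫ t in Ioi (0 : ℝ), ((Real.exp (-(t * ‖k‖ ^ 2)) : ℝ) : ℂ) *
        (symmPart d φ k - heatWeight d t * φ 0) :=
        integral_integral_swap (integrable_exp_mul_symmPart_sub hd φ)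
    _ = _ := by
        refine integral_congr_ae ?_
        filter_upwards [ae_ne_zero hd] with k hk
        exact integral_exp_neg_mul_sub (norm_pos_iff.2 hk) _ _

end HeatFourier

end CutoffGreen

end

noncomputable section

namespace CutoffGreen

/-! ### From the heat regularisation to the finite part with R = 2e^{-γ} -/

section FinitePart

open Set Filter Topology

/-- The difference of the integrands of two finite parts of `1/|k|²`, for the test function `1`. -/
def finitePartGap (d : ℕ) (r : ℝ) : ℝ :=
  if d = 2 then
    (Real.exp (-r ^ 2) - if r < 2 * Real.exp (-Real.eulerMascheroniConstant) then 1 else 0) / r ^ 2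
  else 0

theorem invNormSqIntegrand_eq (d : ℕ) (φ : Space d → ℂ) (k : Space d) :
    invNormSqIntegrand d φ k = (symmPart d φ k - heatSymbol d ‖k‖ * φ 0) / ((‖k‖ ^ 2 : ℝ) : ℂ) +
      finitePartGap d ‖k‖ * φ 0 := by
  by_cases h1 : d = 1
  · simp [invNormSqIntegrand, symmPart, heatSymbol, finitePartGap, h1]
  by_cases h2 : d = 2
  · subst h2
    simp only [invNormSqIntegrand, symmPart, heatSymbol, finitePartGap, h1, if_true, if_false]
    split_ifs <;> push_cast <;> ring
  · simp [invNormSqIntegrand, symmPart, heatSymbol, finitePartGap, h1, h2]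

theorem integral_Ioi_mul_comp_sq (f : ℝ → ℝ) :
    ∫ r in Ioi 0, 2 * r * f (r ^ 2) = ∫ s in Ioi 0, f s := by
  rw [← integral_comp_rpow_Ioi f (p := 2) (by norm_num)]
  refine setIntegral_congr_fun measurableSet_Ioi fun r _ => ?_
  simp only [abs_two, smul_eq_mul, Real.rpow_two]
  norm_num

theorem integrableOn_Ioi_mul_comp_sq {f : ℝ → ℝ} (hf : IntegrableOn f (Ioi 0)) :
    IntegrableOn (fun r => 2 * r * f (r ^ 2)) (Ioi 0) := by
  refine ((integrableOn_Ioi_comp_rpow_iff f (p := 2) (by norm_num)).2 hf).congr_fun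
    (fun r _ => ?_) measurableSet_Ioi
  simp only [abs_two, smul_eq_mul, Real.rpow_two]
  norm_num

theorem mul_finitePartGap_two {r : ℝ} (hr : 0 < r) : r * finitePartGap 2 r =
    2⁻¹ * (2 * r * ((Real.exp (-(r ^ 2)) -
      if r ^ 2 < (2 * Real.exp (-Real.eulerMascheroniConstant)) ^ 2 then 1 else 0) / r ^ 2)) := by
  have h : r ^ 2 < (2 * Real.exp (-Real.eulerMascheroniConstant)) ^ 2 ↔
      r < 2 * Real.exp (-Real.eulerMascheroniConstant) :=
    pow_lt_pow_iff_left₀ hr.le (by positivity) two_ne_zero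
  simp only [finitePartGap, h, if_true]
  ring

theorem integrable_finitePartGap (d : ℕ) : Integrable fun k : Space d => finitePartGap d ‖k‖ := by
  by_cases h2 : d = 2
  · subst h2
    rw [integrable_fun_norm_addHaar, finrank_euclideanSpace_fin]
    have h := (integrableOn_Ioi_mul_comp_sq (integrableOn_exp_neg_sub_indicator_div
      (B := (2 * Real.exp (-Real.eulerMascheroniConstant)) ^ 2) (by positivity))).const_mul 2⁻¹
    refine IntegrableOn.congr_fun h (fun r (hr : 0 < r) => ?_) measurableSet_Ioi
    simp only [Nat.add_one_sub_one, pow_one, smul_eq_mul]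
    exact (mul_finitePartGap_two hr).symm
  · simp [finitePartGap, h2]

theorem volume_real_ball_space (d : ℕ) (hd : 1 ≤ d) :
    d * (volume : Measure (Space d)).real (Metric.ball 0 1) = sphereArea d := by
  have : Nonempty (Fin d) := ⟨⟨0, hd⟩⟩
  have hpi := Real.pi_pos
  have hd' : (0 : ℝ) < d := by exact_mod_cast hd
  have hG := Real.Gamma_pos_of_pos (show (0 : ℝ) < d / 2 by positivity)
  rw [Measure.real, EuclideanSpace.volume_ball, Fintype.card_fin, ENNReal.ofReal_one, one_pow,
    one_mul, Real.Gamma_add_one (by positivity), ENNReal.toReal_ofReal (by positivity), sphereArea,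
    Real.sqrt_eq_rpow, ← Real.rpow_natCast, ← Real.rpow_mul hpi.le,
    show (1 / 2 : ℝ) * d = d / 2 by ring]
  field_simp

/-- For d = 2, polar coordinates and s = r² give π(-γ - log R²) = π(γ - 2 log 2). This value is what
fixes R: by `integral_waveFourier`, it cancels the contribution of `heatConst`. -/
theorem integral_finitePartGap (d : ℕ) :
    ∫ k : Space d, finitePartGap d ‖k‖ = -((2 * Real.pi) ^ d * heatConst d) := by
  by_cases h2 : d = 2
  · subst h2
    have hpi := Real.pi_pos
    have hv := volume_real_ball_space 2 (by norm_num)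
    rw [sphereArea_two] at hv
    have h : ∀ r ∈ Ioi (0 : ℝ), r ^ (2 - 1) • finitePartGap 2 r =
        2⁻¹ * (2 * r * ((Real.exp (-(r ^ 2)) - if r ^ 2 <
          (2 * Real.exp (-Real.eulerMascheroniConstant)) ^ 2 then 1 else 0) / r ^ 2)) :=
      fun r hr => by
        rw [← mul_finitePartGap_two hr]; simp
    rw [integral_fun_norm_addHaar, finrank_euclideanSpace_fin,
      setIntegral_congr_fun measurableSet_Ioi h, integral_const_mul,
      integral_Ioi_mul_comp_sq (fun s => (Real.exp (-s) - if s <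
          (2 * Real.exp (-Real.eulerMascheroniConstant)) ^ 2 then 1 else 0) / s),
      integral_exp_neg_sub_indicator_div (by positivity), Real.log_pow,
      Real.log_mul two_ne_zero (Real.exp_pos _).ne', Real.log_exp, nsmul_eq_mul, smul_eq_mul,
      ← mul_assoc, hv]
    simp only [heatConst, if_true]
    push_cast
    field_simp
    ring
  · simp [finitePartGap, heatConst, h2]

theorem integrable_invNormSqIntegrand {d : ℕ} (hd : 1 ≤ d) (φ : 𝓢(Space d, ℂ)) :
    Integrable (invNormSqIntegrand d φ) := by
  have h : Integrable fun k : Space d => ((finitePartGap d ‖k‖ : ℝ) : ℂ) * φ 0 :=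
    (integrable_finitePartGap d).ofReal.mul_const _
  exact ((integrable_symmPart_sub_heatSymbol hd φ).add h).congr
    (Eventually.of_forall fun k => (invNormSqIntegrand_eq d φ k).symm)

theorem integrable_green_mul' {d : ℕ} (hd : 1 ≤ d) (g : 𝓢(Space d, ℂ)) :
    Integrable fun x : Space d => ((green d ‖x‖ : ℝ) : ℂ) * g x := by
  refine ((integrable_green_mul hd g).sub ((g.integrable (μ := volume)).const_mul
    (heatConst d : ℂ))).congr (Eventually.of_forall fun x => ?_)
  simp only [Pi.sub_apply]
  push_cast
  ring

/-- The Fourier transform of the fundamental solution is the finite part of `1/|k|²`. -/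
theorem integral_invNormSqIntegrand {d : ℕ} (hd : 1 ≤ d) (φ : 𝓢(Space d, ℂ)) :
    ∫ k, invNormSqIntegrand d φ k = ∫ x : Space d, ((green d ‖x‖ : ℝ) : ℂ) * waveFourier d φ x := by
  have h : Integrable fun k : Space d => ((finitePartGap d ‖k‖ : ℝ) : ℂ) * φ 0 :=
    (integrable_finitePartGap d).ofReal.mul_const _
  simp_rw [invNormSqIntegrand_eq]
  rw [integral_add (integrable_symmPart_sub_heatSymbol hd φ) h,
    ← integral_green_mul_waveFourier hd φ, integral_mul_const, integral_complex_ofReal,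
    integral_finitePartGap]
  simp_rw [Complex.ofReal_add, add_mul]
  rw [integral_add (integrable_green_mul' hd _)
    (((waveFourier d φ).integrable (μ := volume)).const_mul _), integral_const_mul,
    integral_waveFourier]
  push_cast
  ring

end FinitePart

/-! ### The cutoff as subtraction of a compactly supported radial potential -/

section Cutoff

open Set Filter Topology

/-- The radial integral `∫_r^a s^{1-d} ds`. -/
def radialPot (d : ℕ) (a r : ℝ) : ℝ := ∫ s in Ioo r a, (s ^ (d - 1))⁻¹

theorem radialPot_eq {d : ℕ} (hd : 1 ≤ d) {a r : ℝ} (hr : 0 < r) (hra : r ≤ a) :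
    radialPot d a r = sphereArea d * (green d r - green d a) := by
  have hpi := Real.pi_pos
  have ha : 0 < a := hr.trans_le hra
  have h0 : (0 : ℝ) ∉ uIcc r a := notMem_uIcc_of_lt hr ha
  rw [radialPot, ← integral_Ioc_eq_integral_Ioo, ← intervalIntegral.integral_of_le hra]
  obtain rfl | rfl | hd : d = 1 ∨ d = 2 ∨ 3 ≤ d := by omega
  · simp [sphereArea_one, green]
    ring
  · simp only [Nat.add_one_sub_one, pow_one, integral_inv_of_pos hr ha,
      Real.log_div ha.ne' hr.ne', sphereArea_two, green]
    norm_num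
    field_simp
    ring
  · have hd' : (3 : ℝ) ≤ d := by exact_mod_cast hd
    have hS := (sphereArea_pos (d := d) (by omega)).ne'
    have e : ∀ s : ℝ, (s ^ (d - 1))⁻¹ = s ^ (1 - (d : ℤ)) := fun s => by
      rw [← zpow_natCast, ← zpow_neg]
      congr 1
      omega
    simp_rw [e]
    rw [integral_zpow (Or.inr ⟨by omega, h0⟩)]
    simp only [green, show d ≠ 1 by omega, show d ≠ 2 by omega, if_false]
    have h2 : (d : ℝ) - 2 ≠ 0 := by linarith
    have h3 : (2 : ℝ) - d ≠ 0 := by linarith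
    rw [show (1 - (d : ℤ) + 1) = 2 - (d : ℤ) by ring,
      show ((1 - (d : ℤ) : ℤ) : ℝ) + 1 = -((d : ℝ) - 2) by push_cast; ring]
    field_simp
    ring

/-- Below 1/Λ this holds because G' = -s^{1-d}/S; above, the interval defining `radialPot` is empty.
-/
theorem green_cutoff {d : ℕ} (hd : 1 ≤ d) (Λ : ℝ) {r : ℝ} (hr : 0 < r) :
    green d (cutoff Λ r) = green d r - (sphereArea d)⁻¹ * radialPot d (1 / Λ) r := by
  have hS := (sphereArea_pos hd).ne'
  unfold cutoff
  split_ifs with h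
  · rw [radialPot, Ioo_eq_empty (not_lt.2 h.le)]
    simp
  · rw [radialPot_eq hd hr (not_lt.1 h)]
    field_simp
    ring

/-- Beyond a = 1/Λ the slope |G'| = s^{1-d}/S is at most its value `L` at a, so the growth is at
most linear in every dimension. -/
theorem abs_green_cutoff_le {d : ℕ} (hd : 1 ≤ d) {Λ : ℝ} (hΛ : 0 < Λ) :
    ∃ C, ∀ r, 0 ≤ r → |green d (cutoff Λ r)| ≤ C * (1 + r) := by
  have ha : 0 < 1 / Λ := by positivity
  set a := 1 / Λ
  have hS := sphereArea_pos hd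
  set L := (sphereArea d)⁻¹ * (a ^ (d - 1))⁻¹
  have hL : 0 ≤ L := by positivity
  refine ⟨|green d a| + L, fun r hr => ?_⟩
  have h0 := abs_nonneg (green d a)
  unfold cutoff
  split_ifs with h
  · have h1 : |radialPot d r a| ≤ (a ^ (d - 1))⁻¹ * (r - a) := by
      have := norm_setIntegral_le_of_norm_le_const (μ := volume) (s := Ioo a r)
        (f := fun s : ℝ => (s ^ (d - 1))⁻¹) (C := (a ^ (d - 1))⁻¹) (by simp) (fun s hs => ?_)
      · rwa [Real.volume_real_Ioo_of_le (le_of_lt h)] at this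
      · have : 0 < s := ha.trans hs.1
        rw [Real.norm_of_nonneg (by positivity)]
        gcongr
        exact hs.1.le
    have h2 := radialPot_eq hd ha (le_of_lt h)
    have h3 : green d r = green d a - (sphereArea d)⁻¹ * radialPot d r a := by
      rw [h2]; field_simp; ring
    rw [h3]
    calc |green d a - (sphereArea d)⁻¹ * radialPot d r a|
        ≤ |green d a| + |(sphereArea d)⁻¹ * radialPot d r a| := abs_sub _ _
      _ ≤ |green d a| + L * (r - a) := by
          rw [abs_mul, abs_of_pos (inv_pos.2 hS)]
          simp only [L, mul_assoc]
          gcongr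
      _ ≤ _ := by nlinarith
  · show |green d a| ≤ _
    nlinarith [mul_nonneg h0 hr, mul_nonneg hL hr]

theorem measurable_green_cutoff (d : ℕ) (Λ : ℝ) : Measurable fun r => green d (cutoff Λ r) := by
  have h1 : Measurable (cutoff Λ) :=
    Measurable.ite measurableSet_Ioi measurable_id measurable_const
  have h2 : Measurable (green d) := by
    unfold green
    split_ifs <;> fun_prop
  exact h2.comp h1

end Cutoff

/-! ### Assembly -/

section Main

open Set Filter Topology

theorem sphereMean_zero_right {d : ℕ} (hd : 1 ≤ d) (k : Space d) :
    sphereMean k 0 = sphereArea d := by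
  rw [← volume_real_ball_space d hd]
  simp [sphereMean, planeWave, Measure.toSphere_real_apply_univ]

theorem sphereWave_eq (d : ℕ) (Λ : ℝ) (k : Space d) : sphereWave d Λ k = sphereMean k (1 / Λ) := by
  simp only [sphereWave, sphereMean, planeWave, real_inner_smul_right]
  congr 1 with y
  congr 3
  ring

/-- The Fourier transform of `radialPot`. -/
def radialPotFourier (d : ℕ) (a : ℝ) (k : Space d) : ℂ :=
  ∫ x : Space d, ((radialPot d a ‖x‖ : ℝ) : ℂ) * planeWave k x

theorem radialPotFourier_neg (d : ℕ) (a : ℝ) (k : Space d) :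
    radialPotFourier d a (-k) = radialPotFourier d a k := by
  unfold radialPotFourier
  rw [← integral_neg_eq_self]
  simp [planeWave]

theorem normSq_mul_radialPotFourier {d : ℕ} (hd : 1 ≤ d) {Λ : ℝ} (hΛ : 0 < Λ) (k : Space d) :
    ((‖k‖ ^ 2 : ℝ) : ℂ) * radialPotFourier d (1 / Λ) k = sphereArea d - sphereWave d Λ k := by
  have : Nonempty (Fin d) := ⟨⟨0, hd⟩⟩
  have h := normSq_mul_integral_planeWave k (a := 1 / Λ) (by positivity)
  rw [finrank_euclideanSpace_fin, sphereMean_zero_right hd, ← sphereWave_eq] at h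
  exact h

theorem integrable_radialPot {d : ℕ} (hd : 1 ≤ d) (a : ℝ) :
    Integrable fun x : Space d => ((radialPot d a ‖x‖ : ℝ) : ℂ) := by
  have : Nonempty (Fin d) := ⟨⟨0, hd⟩⟩
  refine integrable_integral_Ioo_norm (by fun_prop) ?_
  rw [finrank_euclideanSpace_fin]
  exact integrableOn_pow_mul_inv_pow hd a

/-- In `sphereWave` = S - ‖k‖² F the second term vanishes at the origin, so the subtraction in the
finite part does not see it, and its factor ‖k‖² cancels the denominator. Evenness of F is needed
for the symmetrisation in d = 1. -/
theorem invNormSqIntegrand_sphereWave_mul {d : ℕ} (hd : 1 ≤ d) {Λ : ℝ} (hΛ : 0 < Λ)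
    (φ : Space d → ℂ) {k : Space d} (hk : k ≠ 0) :
    invNormSqIntegrand d (fun k => sphereWave d Λ k * φ k) k =
      sphereArea d * invNormSqIntegrand d φ k -
        radialPotFourier d (1 / Λ) k * symmPart d φ k := by
  have hV := normSq_mul_radialPotFourier hd hΛ k
  have hV' := normSq_mul_radialPotFourier hd hΛ (-k)
  have hV0 := normSq_mul_radialPotFourier hd hΛ (0 : Space d)
  rw [norm_neg, radialPotFourier_neg, hV] at hV'
  have hk2 : ((‖k‖ ^ 2 : ℝ) : ℂ) ≠ 0 := by
    have := norm_pos_iff.2 hk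
    exact_mod_cast (by positivity : ‖k‖ ^ 2 ≠ 0)
  have h0 : sphereWave d Λ 0 = sphereArea d := by
    simp only [norm_zero, ne_eq, OfNat.ofNat_ne_zero, not_false_eq_true, zero_pow,
      Complex.ofReal_zero, zero_mul] at hV0
    linear_combination hV0
  have hneg : sphereWave d Λ (-k) = sphereWave d Λ k := by linear_combination hV'
  have hW : sphereWave d Λ k = sphereArea d - ((‖k‖ ^ 2 : ℝ) : ℂ) * radialPotFourier d (1 / Λ) k := by
    linear_combination hV
  simp only [invNormSqIntegrand, symmPart, h0, hneg]
  rw [hW]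
  split_ifs <;> field_simp <;> ring

theorem mul_symmPart (d : ℕ) {w φ : Space d → ℂ} (hw : ∀ k, w (-k) = w k) (k : Space d) :
    w k * symmPart d φ k = symmPart d (fun k => w k * φ k) k := by
  unfold symmPart
  split_ifs
  · simp only [hw]; ring
  · rfl

/-- The pointwise splitting off the origin reduces everything to φ itself, so `sphereWave` · φ need
not be known to be a Schwartz function. -/
theorem integrable_and_integral_invNormSqIntegrand_sphereWave_mul {d : ℕ} (hd : 1 ≤ d) {Λ : ℝ}
    (hΛ : 0 < Λ) (φ : 𝓢(Space d, ℂ)) :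
    Integrable (invNormSqIntegrand d (fun k => sphereWave d Λ k * φ k)) ∧
      ∫ k, invNormSqIntegrand d (fun k => sphereWave d Λ k * φ k) k =
        sphereArea d * ∫ x : Space d, ((green d (cutoff Λ ‖x‖) : ℝ) : ℂ) * waveFourier d φ x := by
  have hS : (sphereArea d : ℂ) ≠ 0 := by exact_mod_cast (sphereArea_pos hd).ne'
  have hφ := φ.integrable (μ := volume)
  have hD := integrable_radialPot hd (1 / Λ)
  have hV : Integrable fun k => radialPotFourier d (1 / Λ) k * φ k :=
    integrable_integral_planeWave_mul hD hφ
  have hVs : Integrable fun k => radialPotFourier d (1 / Λ) k * symmPart d φ k := by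
    simp_rw [mul_symmPart d (radialPotFourier_neg d (1 / Λ))]
    exact integrable_symmPart d hV
  have hN := (integrable_invNormSqIntegrand hd φ).const_mul (sphereArea d : ℂ)
  have hae : (fun k => sphereArea d * invNormSqIntegrand d φ k -
      radialPotFourier d (1 / Λ) k * symmPart d φ k) =ᵐ[volume]
      invNormSqIntegrand d (fun k => sphereWave d Λ k * φ k) := by
    filter_upwards [ae_ne_zero hd] with k hk
    exact (invNormSqIntegrand_sphereWave_mul hd hΛ φ hk).symm
  refine ⟨(hN.sub hVs).congr hae, ?_⟩
  have hDφ : Integrable fun x : Space d =>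
      ((radialPot d (1 / Λ) ‖x‖ : ℝ) : ℂ) * waveFourier d φ x := by
    obtain ⟨M, -, hM⟩ := (waveFourier d φ).decay 0 0
    simp only [pow_zero, one_mul, norm_iteratedFDeriv_zero] at hM
    exact hD.mul_bdd (c := M) (waveFourier d φ).continuous.aestronglyMeasurable
      (Eventually.of_forall hM)
  have hG : ∫ x : Space d, ((green d (cutoff Λ ‖x‖) : ℝ) : ℂ) * waveFourier d φ x =
      ∫ x : Space d, (((green d ‖x‖ : ℝ) : ℂ) * waveFourier d φ x - (sphereArea d : ℂ)⁻¹ *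
        (((radialPot d (1 / Λ) ‖x‖ : ℝ) : ℂ) * waveFourier d φ x)) := by
    refine integral_congr_ae ?_
    filter_upwards [ae_ne_zero hd] with x hx
    rw [green_cutoff hd Λ (norm_pos_iff.2 hx)]
    push_cast
    ring
  have hDV : ∫ x : Space d, ((radialPot d (1 / Λ) ‖x‖ : ℝ) : ℂ) * waveFourier d φ x =
      ∫ k, radialPotFourier d (1 / Λ) k * symmPart d φ k := by
    rw [integral_mul_symmPart d (radialPotFourier_neg d (1 / Λ)) hV]
    simp_rw [waveFourier_eq]
    exact integral_mul_integral_planeWave hD hφ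
  rw [← integral_congr_ae hae, integral_sub hN hVs, integral_const_mul,
    integral_invNormSqIntegrand hd φ, hG, integral_sub (integrable_green_mul' hd _)
    (hDφ.const_mul _), integral_const_mul, hDV, mul_sub, mul_inv_cancel_left₀ hS]

end Main

end CutoffGreen

end

theorem mainTheorem4 (d : ℕ) (hd : 1 ≤ d) (Λ : ℝ) (hΛ : 0 < Λ) :
    ∃ T U : 𝓢'(CutoffGreen.Space d, ℂ),
      CutoffGreen.IsCutoffGreen d Λ T ∧
      CutoffGreen.IsSphereWaveOverNormSq d Λ U ∧
      CutoffGreen.distFourier d T = U := by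
  obtain ⟨C, hC⟩ := CutoffGreen.abs_green_cutoff_le hd hΛ
  obtain ⟨T, hT⟩ := CutoffGreen.exists_temperedDistribution_of_norm_le
    (f := fun x : CutoffGreen.Space d => ((CutoffGreen.green d (CutoffGreen.cutoff Λ ‖x‖) : ℝ) : ℂ))
    (Complex.measurable_ofReal.comp
      ((CutoffGreen.measurable_green_cutoff d Λ).comp measurable_norm)).aestronglyMeasurable
    (C := C) (fun x => by
      rw [Complex.norm_real, Real.norm_eq_abs]
      exact hC ‖x‖ (norm_nonneg x))
  -- Taking U to be the transform of T makes its continuity automatic; only the formula for its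
  -- values remains.
  refine ⟨T, CutoffGreen.distFourier d T, hT, fun φ => ?_, rfl⟩
  obtain ⟨hi, hv⟩ :=
    CutoffGreen.integrable_and_integral_invNormSqIntegrand_sphereWave_mul hd hΛ φ
  have hS : (CutoffGreen.sphereArea d : ℂ) ≠ 0 := by
    exact_mod_cast (CutoffGreen.sphereArea_pos hd).ne'
  refine ⟨hi, ?_⟩
  rw [CutoffGreen.distFourier_apply, (hT _).2, hv, one_div, inv_mul_cancel_left₀ hS]
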